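/- For $S\subset[0,1]^2$, $F:[0,1]^2\to\mathbb C$ and $x\in\mathbb R^3$ put $$E_SF(x)=\int_S F(\xi)\,e^{2\pi i(\xi,|\xi|^2)\cdot x}\,d\xi ,\qquad EF=E_{[0,1]^2}F .$$ When $R\ge 1$ is the square of an integer, let $\mathcal Q_R$ be the collection of the $R$ squares $[\frac{j}{\sqrt R},\frac{j+1}{\sqrt R}]\times[\frac{i}{\sqrt R},\frac{i+1}{\sqrt R}]$, $0\le i,j<\sqrt R$; an $M$-set is a union of $M$ distinct squares of $\mathcal Q_R$. For a ball $B$ of radius $R$ centred at $c$ let $w_B(x)=(1+|x-c|/R)^{-\kappa}$, where $\kappa>3$ is fixed, and write $\|f\|_{L^p(w_B)}^p=\int_{\mathbb R^3}|f|^pw_B$. **Theorem.** Let $0<\gamma\le 1$, $p\in[2,4]$, $\kappa>3$, $a>0$ and $b\in\mathbb R$. Let $\mathcal A$ be any set of pairs $(R,M)$ of positive integers such that $R$ is a perfect square, $M$ divides $R$ and $aR^{1-\gamma}\le M\le bR^{1-\gamma}$ (for example the set of all such pairs). Assume that for every $\epsilon>0$ there is a constant $C_\epsilon$ such that for every $(R,M)\in\mathcal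 A$, every partition of $\mathcal Q_R$ into $M$-sets $P_1,\dots,P_{R/M}$, every integrable $F:[0,1]^2\to\mathbb C$ and every ball $B_R\subset\mathbb R^3$ of radius $R$, $$\|EF\|_{L^p(B_R)}^p\le C_\epsilon R^\epsilon\Big(\frac RM\Big)^{\frac p2-1}\sum_{j=1}^{R/M}\|E_{P_j}F\|_{L^p(w_{B_R})}^p .$$ Then for every $\epsilon>0$ and every $K$ there is a constant $C'$ such that for every $(R,M)\in\mathcal A$, every measurable $F:[0,1]^2\to\mathbb C$ with $\|F\|_\infty\le KR$ and every ball $B_{\sqrt R}\subset\mathbb R^3$ of radius $\sqrt R$, $$\int_{B_{\sqrt R}}|EF|^p\le C'R^\epsilon\Big(R^{\frac{3+p}2}+R^3\Big(\frac RM\Big)^{\frac p2-1}\Big).$$ -/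

import Mathlib

open MeasureTheory

noncomputable section

namespace LargeEnsemble

/-- The frequency plane, with the Euclidean norm. -/
abbrev Plane : Type := EuclideanSpace ℝ (Fin 2)

/-- Physical space, with the Euclidean norm. -/
abbrev Space : Type := EuclideanSpace ℝ (Fin 3)

/-- The unit square `[0,1]²`. -/
def unitSquare : Set Plane := {ξ | ∀ i, ξ i ∈ Set.Icc (0 : ℝ) 1}

/-- `e(t) = exp (2 π i t)`. -/
def e (t : ℝ) : ℂ := Complex.exp (2 * Real.pi * t * Complex.I)

/-- The point `(ξ, |ξ|²)` of the paraboloid above `ξ`. -/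
def lift (ξ : Plane) : Space := !₂[ξ 0, ξ 1, ‖ξ‖ ^ 2]

/-- The extension operator `E_S F(x) = ∫_S F(ξ) e((ξ, |ξ|²) · x) dξ`. -/
def ext (S : Set Plane) (F : Plane → ℂ) (x : Space) : ℂ :=
  ∫ ξ in S, F ξ * e (inner ℝ (lift ξ) x)

/-- The canonical square `[j/n, (j+1)/n] × [i/n, (i+1)/n]` at scale `R = n²`
(so that its side length is `R^(-1/2) = 1/n`). The index type of these squares is
`Fin n × Fin n`. -/
def canonicalSquare (n : ℕ) (q : Fin n × Fin n) : Set Plane :=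
  {ξ | ξ 0 ∈ Set.Icc ((q.1 : ℝ) / n) (((q.1 : ℝ) + 1) / n) ∧
       ξ 1 ∈ Set.Icc ((q.2 : ℝ) / n) (((q.2 : ℝ) + 1) / n)}

/-- The region covered by a family of canonical squares: a large ensemble. -/
def ensemble (n : ℕ) (P : Finset (Fin n × Fin n)) : Set Plane :=
  ⋃ q ∈ P, canonicalSquare n q

/-- The standard weight adapted to the ball with centre `c` and radius `r`: it is comparable to `1`
on the ball, and decays polynomially, with exponent `κ`, away from it. -/
def ballWeight (κ : ℝ) (c : Space) (r : ℝ) (x : Space) : ℝ :=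
  (1 + ‖x - c‖ / r) ^ (-κ)

/-- Large ensemble `l^p` decoupling at scale `R = n²` into `M`-sets, with constant
`D (R/M)^(p/2-1)`: for every partition of the canonical squares into families of exactly `M`
squares, every integrable `F` on the unit square and every ball of radius `R`. -/
def DecouplesWith (p κ : ℝ) (n M : ℕ) (D : ℝ) : Prop :=
  ∀ P : Finpartition (Finset.univ : Finset (Fin n × Fin n)), (∀ A ∈ P.parts, A.card = M) →
  ∀ F : Plane → ℂ, IntegrableOn F unitSquare →
  ∀ c : Space,
    ∫ x in Metric.ball c ((n : ℝ) ^ 2), ‖ext unitSquare F x‖ ^ p ≤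
      D * ((n : ℝ) ^ 2 / M) ^ (p / 2 - 1) *
        ∑ A ∈ P.parts, ∫ x, ‖ext (ensemble n A) F x‖ ^ p * ballWeight κ c ((n : ℝ) ^ 2) x

end LargeEnsemble

end

noncomputable section

namespace LargeEnsemble

/-! Write `R = n²` and `k = R/M`. On a ball of radius about `√R` the function `EF` is governed by
the integrals of `F` over the canonical squares, and a modulation of `F` moves the ball to the
origin. So it is enough to treat step functions `f`, for which every `E_q f` is one wave packet of
size at most 1 along a tube through the origin. For such `f` the ball may be enlarged to radius `R`,
where the hypothesis applies: the tubes form a bush that thins out away from its centre, and `∑_q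
|E_q f|² ≲ 1 + n⁴/(n² + |x|²)` (`sum_norm_ext_stepFun_sq_le`).

The freedom in the hypothesis is the choice of partition. Divide the squares into `M` groups of `k`
and form a part by drawing one square from each group, uniformly and independently; the cyclic
shifts of one draw form a partition into `M`-sets (`choicePartition`). The random sum `E_P f` has
mean `k⁻¹ Ef` and variance at most `V = k⁻¹ ∑_q |E_q f|²`. Rosenthal's inequality in the fourth
moment, interpolated with the second, bounds the mean of `|E_P f|^p` by a constant times `k^(-p)
|Ef|^p + V^(p/2) + V` (`sum_norm_random_choice_rpow_le`).

Averaging the decoupling inequality over all draws multiplies this by `k · k^(p/2-1)`. The square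
function terms become `∫ (∑|E_q f|²)^(p/2)` and `k^(p/2-1) ∫ ∑|E_q f|²`, which the bush estimate
bounds by the two terms of the theorem, up to `R^ε`. What remains is the coherent term `R^δ k^(-p/2)
∫ |Ef|^p w`. Since `k ≳ R^γ`, it is absorbed into the left-hand side once the supremum over all
balls of radius `R` is taken (`integral_ball_ext_stepFun_le`). Where `R` is too small for this, the
trivial bound suffices.

The return from step functions to `F` (`eLpNorm_ext_le_of_stepFun`) expands the phase in a Taylor
series about the corners of the squares. Each term is again an exponential sum over the corners with
admissible coefficients, times a geometrically small factor, so the best constant for such sums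
bounds itself with a factor `1/4`. -/

/-! ### One-dimensional oscillatory integrals. -/

lemma norm_e (t : ℝ) : ‖e t‖ = 1 := by
  unfold e
  have : (2 * Real.pi * t * Complex.I : ℂ) = ((2 * Real.pi * t : ℝ) : ℂ) * Complex.I := by
    push_cast; ring
  rw [this, Complex.norm_exp_ofReal_mul_I]

lemma e_add (s t : ℝ) : e (s + t) = e s * e t := by
  unfold e
  rw [← Complex.exp_add]
  congr 1
  push_cast
  ring

@[fun_prop]
lemma continuous_e : Continuous e := by
  unfold e
  fun_prop

lemma hasDerivAt_e (t : ℝ) : HasDerivAt e (2 * Real.pi * Complex.I * e t) t := by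
  have h1 : HasDerivAt (fun s : ℝ => (2 * Real.pi * s * Complex.I : ℂ))
      (2 * Real.pi * 1 * Complex.I) t :=
    ((Complex.ofRealCLM.hasDerivAt (x := t)).const_mul (2 * Real.pi : ℂ)).mul_const Complex.I
  have h2 := h1.cexp
  unfold e
  convert h2 using 1
  ring

/-- Integration by parts for the quadratic phase `t x + t² h` away from its stationary point. -/
lemma norm_integral_e_quadratic_le {x h α β lam : ℝ} (hαβ : α ≤ β) (hlam : 0 < lam)
    (hφ : ∀ t ∈ Set.Icc α β, lam ≤ |x + 2 * t * h|) (hh : |h| * (β - α) ≤ 2 * lam) :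
    ‖∫ t in α..β, e (t * x + t ^ 2 * h)‖ ≤ 1 / lam := by
  have hpi := Real.pi_gt_three
  have hne : ∀ t ∈ Set.Icc α β, (x + 2 * t * h) ≠ 0 := fun t ht h0 => by
    have := hφ t ht
    rw [h0, abs_zero] at this
    linarith
  set g : ℝ → ℂ := fun t => e (t * x + t ^ 2 * h) * (((x + 2 * t * h)⁻¹ : ℝ) : ℂ) with hg
  set r : ℝ → ℂ := fun t => e (t * x + t ^ 2 * h) * ((2 * h / (x + 2 * t * h) ^ 2 : ℝ) : ℂ) with hr
  have hderiv : ∀ t ∈ Set.uIcc α β,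
      HasDerivAt g (2 * Real.pi * Complex.I * e (t * x + t ^ 2 * h) - r t) t := by
    intro t ht
    rw [Set.uIcc_of_le hαβ] at ht
    have h0 := hne t ht
    have h1 : HasDerivAt (fun t : ℝ => t * x + t ^ 2 * h) (x + 2 * t * h) t := by
      have := ((hasDerivAt_id t).mul_const x).add (((hasDerivAt_id t).pow 2).mul_const h)
      convert! this using 1
      simp
    have h2 : HasDerivAt (fun t : ℝ => e (t * x + t ^ 2 * h))
        ((x + 2 * t * h) • (2 * Real.pi * Complex.I * e (t * x + t ^ 2 * h))) t :=
      (hasDerivAt_e _).scomp t h1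
    have h3 : HasDerivAt (fun t : ℝ => x + 2 * t * h) (2 * h) t := by
      have := (((hasDerivAt_id t).const_mul 2).mul_const h).const_add x
      convert! this using 1
      simp
    have h4 : HasDerivAt (fun t : ℝ => (((x + 2 * t * h)⁻¹ : ℝ) : ℂ))
        ((-(2 * h) / (x + 2 * t * h) ^ 2 : ℝ) : ℂ) t := (h3.inv h0).ofReal_comp
    have h5 := h2.mul h4
    convert! h5 using 1
    have h0' : ((x + 2 * t * h : ℝ) : ℂ) ≠ 0 := by exact_mod_cast h0
    simp only [hr, Complex.real_smul]
    generalize x + 2 * t * h = z at h0'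
    push_cast
    field_simp
    ring
  have hcont : ContinuousOn (fun t => 2 * Real.pi * Complex.I * e (t * x + t ^ 2 * h))
      (Set.uIcc α β) := by fun_prop
  have hrcont : ContinuousOn r (Set.uIcc α β) := by
    rw [Set.uIcc_of_le hαβ]
    simp only [hr]
    refine ContinuousOn.mul (by fun_prop) ?_
    refine Complex.continuous_ofReal.comp_continuousOn ?_
    exact ContinuousOn.div (by fun_prop) (by fun_prop) fun t ht => pow_ne_zero _ (hne t ht)
  have hFTC := intervalIntegral.integral_eq_sub_of_hasDerivAt hderiv
    (hcont.sub hrcont).intervalIntegrable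
  rw [intervalIntegral.integral_sub hcont.intervalIntegrable hrcont.intervalIntegrable,
    intervalIntegral.integral_const_mul] at hFTC
  have hgb : ∀ t ∈ Set.Icc α β, ‖g t‖ ≤ 1 / lam := by
    intro t ht
    simp only [hg, norm_mul, norm_e, one_mul, Complex.norm_real, norm_inv, Real.norm_eq_abs]
    rw [one_div]
    exact inv_anti₀ hlam (hφ t ht)
  have hrb : ∀ t ∈ Set.uIoc α β, ‖r t‖ ≤ 2 * |h| / lam ^ 2 := by
    intro t ht
    rw [Set.uIoc_of_le hαβ] at ht
    have := hφ t ⟨ht.1.le, ht.2⟩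
    simp only [hr, norm_mul, norm_e, one_mul, Complex.norm_real, norm_div, Real.norm_eq_abs,
      abs_two, norm_pow]
    gcongr
  have hrI := intervalIntegral.norm_integral_le_of_norm_le_const hrb
  rw [abs_of_nonneg (sub_nonneg.2 hαβ)] at hrI
  have hkey : 2 * Real.pi * ‖∫ t in α..β, e (t * x + t ^ 2 * h)‖ ≤
      1 / lam + 1 / lam + 2 * |h| / lam ^ 2 * (β - α) := by
    have heq : (2 * Real.pi * Complex.I : ℂ) * ∫ t in α..β, e (t * x + t ^ 2 * h) =
        g β - g α + ∫ t in α..β, r t := by rw [← hFTC]; ring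
    have hn := congrArg norm heq
    rw [norm_mul] at hn
    have h2pi : ‖(2 * Real.pi * Complex.I : ℂ)‖ = 2 * Real.pi := by
      simp [abs_of_pos Real.pi_pos]
    rw [h2pi] at hn
    rw [hn]
    refine (norm_add_le _ _).trans (add_le_add ((norm_sub_le _ _).trans (add_le_add ?_ ?_)) hrI)
    · exact hgb _ (Set.right_mem_Icc.2 hαβ)
    · exact hgb _ (Set.left_mem_Icc.2 hαβ)
  have hlast : 2 * |h| / lam ^ 2 * (β - α) ≤ 4 * (1 / lam) := by
    rw [div_mul_eq_mul_div, div_le_iff₀ (by positivity)]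
    have : 4 * (1 / lam) * lam ^ 2 = 4 * lam := by field_simp
    rw [this]
    nlinarith
  -- The boundary terms and the remainder add up to `6 / lam`, which `2π > 6` absorbs.
  have hl : 0 < 1 / lam := by positivity
  nlinarith [norm_nonneg (∫ t in α..β, e (t * x + t ^ 2 * h))]

/-- The integral of the quadratic phase over the `j`-th interval of length `1/n`. -/
def intervalWave (n j : ℕ) (x h : ℝ) : ℂ :=
  ∫ t in ((j : ℝ) / n)..(((j : ℝ) + 1) / n), e (t * x + t ^ 2 * h)

lemma norm_intervalWave_le (n j : ℕ) (x h : ℝ) : ‖intervalWave n j x h‖ ≤ 1 / n := by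
  unfold intervalWave
  have := intervalIntegral.norm_integral_le_of_norm_le_const
    (a := (j : ℝ) / n) (b := ((j : ℝ) + 1) / n) (f := fun t => e (t * x + t ^ 2 * h)) (C := 1)
    (fun t _ => (norm_e _).le)
  refine this.trans (le_of_eq ?_)
  rw [one_mul, ← sub_div, add_sub_cancel_left, abs_of_nonneg (by positivity)]

lemma natCast_mul_norm_intervalWave_le_one (n j : ℕ) (x h : ℝ) :
    n * ‖intervalWave n j x h‖ ≤ 1 := by
  rcases Nat.eq_zero_or_pos n with rfl | hn
  · simp
  · have : (0 : ℝ) < n := by exact_mod_cast hn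
    have := norm_intervalWave_le n j x h
    rw [le_div_iff₀ (by positivity)] at this
    linarith

/-! ### Square sums of one-dimensional waves and the geometry of the bush. -/

/-- The function `s / (l + |s|)` has derivative `l / (l + |s|)²`, and `|s| ≤ |t| + 1` on `[t, t +
1]`. -/
lemma one_div_sq_le_telescope {l t : ℝ} (hl : 1 ≤ l) :
    l * (1 / (l + 1 + |t|) ^ 2) ≤ (t + 1) / (l + |t + 1|) - t / (l + |t|) := by
  have hA : 0 < l + |t| := by positivity
  have hB : 0 < l + |t + 1| := by positivity
  have hC : 0 < l + 1 + |t| := by positivity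
  rw [div_sub_div _ _ hB.ne' hA.ne', mul_one_div, div_le_div_iff₀ (by positivity) (by positivity)]
  rcases le_or_gt 0 t with ht | ht
  · rw [abs_of_nonneg ht, abs_of_nonneg (by linarith : 0 ≤ t + 1)]
    nlinarith [mul_nonneg (by positivity : 0 ≤ l) (by positivity : 0 ≤ l + 1 + t)]
  · rw [abs_of_neg ht]
    rcases le_or_gt 0 (t + 1) with ht' | ht'
    · rw [abs_of_nonneg ht']
      have h1 : (l + (t + 1)) * (l + -t) ≤ (l + 1 + -t) ^ 2 := by nlinarith
      have h2 : l ≤ (t + 1) * (l + -t) - (l + (t + 1)) * t := by nlinarith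
      calc _ ≤ l * (l + 1 + -t) ^ 2 := by gcongr
        _ ≤ _ := by gcongr
    · rw [abs_of_neg ht']
      have h1 : (l + -(t + 1)) * (l + -t) ≤ (l + 1 + -t) ^ 2 := by nlinarith
      have h2 : l ≤ (t + 1) * (l + -t) - (l + -(t + 1)) * t := by nlinarith
      calc _ ≤ l * (l + 1 + -t) ^ 2 := by gcongr
        _ ≤ _ := by gcongr

lemma sum_one_div_add_abs_sub_sq_le {L : ℝ} (hL : 2 ≤ L) (τ : ℝ) (n : ℕ) :
    ∑ j ∈ Finset.range n, 1 / (L + |(j : ℝ) - τ|) ^ 2 ≤ 4 / L := by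
  set u : ℝ → ℝ := fun t => t / (L - 1 + |t|) with hu
  have hu1 : ∀ t, |u t| ≤ 1 := fun t => by
    simp only [hu]
    have hpos : 0 < L - 1 + |t| := by have := abs_nonneg t; linarith
    rw [abs_div, abs_of_pos hpos, div_le_one hpos]
    linarith
  have hstep : ∀ j : ℕ, (L - 1) * (1 / (L + |(j : ℝ) - τ|) ^ 2) ≤
      u ((j + 1 : ℕ) - τ) - u (j - τ) := fun j => by
    have := one_div_sq_le_telescope (l := L - 1) (t := j - τ) (by linarith)
    simp only [hu]
    push_cast
    rw [show (j : ℝ) + 1 - τ = j - τ + 1 by ring]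
    convert this using 4
    ring
  have hsum := Finset.sum_le_sum fun j (_ : j ∈ Finset.range n) => hstep j
  rw [← Finset.mul_sum, Finset.sum_range_sub (fun j : ℕ => u (j - τ))] at hsum
  have h1 := hu1 (n - τ)
  have h2 := hu1 ((0 : ℕ) - τ)
  rw [abs_le] at h1 h2
  -- The telescoped sum is at most 2, and `L - 1 ≥ L / 2`; hence the constant 4.
  rw [le_div_iff₀ (by linarith)]
  have hnn : 0 ≤ ∑ j ∈ Finset.range n, 1 / (L + |(j : ℝ) - τ|) ^ 2 :=
    Finset.sum_nonneg fun _ _ => by positivity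
  generalize ∑ j ∈ Finset.range n, 1 / (L + |(j : ℝ) - τ|) ^ 2 = S at hsum hnn ⊢
  nlinarith [mul_nonneg hnn (sub_nonneg.2 hL)]

/-- The sum over the intervals of length `1/n` of the squares of the normalized waves. -/
def waveSquareSum (n : ℕ) (x h : ℝ) : ℝ :=
  ∑ j ∈ Finset.range n, (n * ‖intervalWave n j x h‖) ^ 2

lemma waveSquareSum_nonneg (n : ℕ) (x h : ℝ) : 0 ≤ waveSquareSum n x h :=
  Finset.sum_nonneg fun _ _ => by positivity

lemma waveSquareSum_le (n : ℕ) (x h : ℝ) : waveSquareSum n x h ≤ n := by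
  unfold waveSquareSum
  calc _ ≤ ∑ j ∈ Finset.range n, (1 : ℝ) := Finset.sum_le_sum fun j _ =>
        pow_le_one₀ (by positivity) (natCast_mul_norm_intervalWave_le_one n j x h)
    _ = n := by simp

/-- The phase is stationary at `-x/(2h)`, which in units of `1/n` is `τ`. On the `j`-th interval its
derivative has size about `|h| |j - τ| / n`, so the normalized wave is at most a constant times
`min(1, m / |j - τ|)` with `m = n²/|h|`: about `2 + m` intervals contribute, and the rest decays
quadratically. -/
lemma waveSquareSum_le_of_height (n : ℕ) (x : ℝ) {h : ℝ} (hh : h ≠ 0) :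
    waveSquareSum n x h ≤ 16 * (2 + n ^ 2 / |h|) := by
  rcases Nat.eq_zero_or_pos n with rfl | hn
  · simp [waveSquareSum]
  have hn' : (0 : ℝ) < n := by exact_mod_cast hn
  have hh' : 0 < |h| := abs_pos.2 hh
  set m : ℝ := n ^ 2 / |h| with hm
  have hm0 : 0 < m := by positivity
  set L : ℝ := 2 + m with hL
  set τ : ℝ := -(n * x / (2 * h)) with hτ
  have hterm : ∀ j ∈ Finset.range n, (n * ‖intervalWave n j x h‖) ^ 2 ≤
      4 * L ^ 2 * (1 / (L + |(j : ℝ) - τ|) ^ 2) := by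
    intro j _
    have hone := natCast_mul_norm_intervalWave_le_one n j x h
    set d := |(j : ℝ) - τ| with hd
    have hd0 : 0 ≤ d := abs_nonneg _
    have hLd : 0 < L + d := by positivity
    have hmain : n * ‖intervalWave n j x h‖ ≤ 2 * L / (L + d) := by
      rw [le_div_iff₀ hLd]
      rcases le_or_gt d L with hdL | hdL
      · nlinarith [norm_nonneg (intervalWave n j x h)]
      · have hd2 : 2 < d := by linarith
        have hlam : 0 < |h| * d / n := by positivity
        have hI : ‖intervalWave n j x h‖ ≤ 1 / (|h| * d / n) := by
          refine norm_integral_e_quadratic_le (by gcongr; linarith) hlam ?_ ?_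
          · intro t ht
            have e1 : x + 2 * t * h = 2 * h / n * (n * t - τ) := by
              rw [hτ]; field_simp; ring
            rw [e1, abs_mul, abs_div, abs_mul, abs_two, abs_of_pos hn']
            have h1 : (j : ℝ) ≤ n * t := by
              have := ht.1; rw [div_le_iff₀ hn'] at this; linarith
            have h2 : n * t ≤ j + 1 := by
              have := ht.2; rw [le_div_iff₀ hn'] at this; linarith
            have h3 : d / 2 ≤ |n * t - τ| := by
              have : d ≤ |n * t - τ| + |(j : ℝ) - n * t| := by
                rw [hd]
                have := abs_add_le (n * t - τ) (j - n * t)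
                rwa [show (n * t - τ) + (j - n * t) = j - τ by ring] at this
              have h4 : |(j : ℝ) - n * t| ≤ 1 := by rw [abs_le]; constructor <;> linarith
              linarith
            calc |h| * d / n = 2 * |h| / n * (d / 2) := by ring
              _ ≤ _ := by gcongr
          · have : ((j : ℝ) + 1) / n - j / n = 1 / n := by ring
            rw [this, mul_one_div, mul_div_assoc', div_le_div_iff_of_pos_right hn']
            nlinarith
        have h5 : n * ‖intervalWave n j x h‖ ≤ m / d := by
          calc _ ≤ n * (1 / (|h| * d / n)) := by gcongr
            _ = m / d := by rw [hm]; field_simp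
        have h6 : m / d * (L + d) ≤ 2 * L := by
          rw [div_mul_eq_mul_div, div_le_iff₀ (by linarith)]
          nlinarith
        calc _ ≤ m / d * (L + d) := by gcongr
          _ ≤ _ := h6
    calc _ ≤ (2 * L / (L + d)) ^ 2 := by gcongr
      _ = _ := by field_simp; ring
  calc waveSquareSum n x h ≤ ∑ j ∈ Finset.range n, 4 * L ^ 2 * (1 / (L + |(j : ℝ) - τ|) ^ 2) :=
        Finset.sum_le_sum hterm
    _ ≤ 4 * L ^ 2 * (4 / L) := by
        rw [← Finset.mul_sum]
        gcongr
        exact sum_one_div_add_abs_sub_sq_le (by linarith) τ n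
    _ = 16 * L := by field_simp; ring

/-- Here the phase has no stationary point in `[0, 1]`: its derivative is at least `|x| / 2`
throughout. -/
lemma waveSquareSum_le_of_far {n : ℕ} {x h : ℝ} (hx : x ≠ 0) (hxh : 4 * |h| ≤ |x|) :
    waveSquareSum n x h ≤ 4 * n ^ 3 / x ^ 2 := by
  rcases Nat.eq_zero_or_pos n with rfl | hn
  · simp [waveSquareSum]
  have hn' : (0 : ℝ) < n := by exact_mod_cast hn
  have hn1 : (1 : ℝ) ≤ n := by exact_mod_cast hn
  have hx' : 0 < |x| := abs_pos.2 hx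
  have hterm : ∀ j ∈ Finset.range n, (n * ‖intervalWave n j x h‖) ^ 2 ≤ 4 * n ^ 2 / x ^ 2 := by
    intro j hj
    have hj' : (j : ℝ) + 1 ≤ n := by exact_mod_cast Finset.mem_range.1 hj
    have hI : ‖intervalWave n j x h‖ ≤ 1 / (|x| / 2) := by
      refine norm_integral_e_quadratic_le (by gcongr; linarith) (by positivity) ?_ ?_
      · intro t ht
        have h0 : 0 ≤ t := le_trans (by positivity) ht.1
        have h1 : t ≤ 1 := ht.2.trans (by rw [div_le_one hn']; exact hj')
        have h2 : |2 * t * h| ≤ 2 * |h| := by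
          rw [abs_mul, abs_mul, abs_two, abs_of_nonneg h0]
          nlinarith [abs_nonneg h]
        have h3 := abs_sub_abs_le_abs_sub x (-(2 * t * h))
        rw [abs_neg, sub_neg_eq_add] at h3
        linarith
      · have : ((j : ℝ) + 1) / n - j / n = 1 / n := by ring
        rw [this, mul_one_div]
        have : |h| / n ≤ |h| := div_le_self (abs_nonneg h) hn1
        linarith [abs_nonneg h]
    calc _ ≤ (n * (1 / (|x| / 2))) ^ 2 := by gcongr
      _ = 4 * n ^ 2 / |x| ^ 2 := by field_simp; ring
      _ = _ := by rw [sq_abs]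
  calc waveSquareSum n x h ≤ ∑ j ∈ Finset.range n, (4 * n ^ 2 / x ^ 2 : ℝ) :=
        Finset.sum_le_sum hterm
    _ = _ := by simp; ring

/-- Either the larger horizontal coordinate dominates the height and one factor is already small, or
the height is comparable to `r` and both factors are at most a constant times `2 + n²/|h|`. -/
lemma waveSquareSum_mul_le_of_far {n : ℕ} {x y h r : ℝ} (hr : (n : ℝ) < r)
    (hr2 : r ^ 2 = x ^ 2 + y ^ 2 + h ^ 2) (hyx : |y| ≤ |x|) :
    waveSquareSum n x h * waveSquareSum n y h ≤ 100000 * (1 + n ^ 4 / r ^ 2) := by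
  have hn0 : (0 : ℝ) ≤ n := n.cast_nonneg
  have hr0 : 0 < r := by linarith
  have hy2 : y ^ 2 ≤ x ^ 2 := sq_le_sq.2 hyx
  rcases le_or_gt (4 * |h|) |x| with hxh | hxh
  · have hx : x ≠ 0 := by
      rintro rfl
      rw [abs_zero] at hxh hyx
      have h1 : y = 0 := abs_eq_zero.1 (le_antisymm hyx (abs_nonneg _))
      have h2 : h = 0 := abs_eq_zero.1 (le_antisymm (by linarith [abs_nonneg h]) (abs_nonneg _))
      subst h1 h2
      nlinarith
    have hh2 : h ^ 2 ≤ x ^ 2 := sq_le_sq.2 (by linarith [abs_nonneg h])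
    have hx2 : 0 < x ^ 2 := by positivity
    calc _ ≤ 4 * n ^ 3 / x ^ 2 * n := by
          gcongr
          · exact waveSquareSum_nonneg _ _ _
          · exact waveSquareSum_le_of_far hx hxh
          · exact waveSquareSum_le _ _ _
      _ = 4 * n ^ 4 / x ^ 2 := by ring
      _ ≤ 12 * (n ^ 4 / r ^ 2) := by
          rw [mul_div_assoc', div_le_div_iff₀ hx2 (by positivity)]
          have : r ^ 2 ≤ 3 * x ^ 2 := by linarith
          have h4 : (0 : ℝ) ≤ n ^ 4 := by positivity
          nlinarith
      _ ≤ _ := by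
          have : 0 ≤ (n : ℝ) ^ 4 / r ^ 2 := by positivity
          linarith
  · have hh : h ≠ 0 := by
      rintro rfl
      rw [abs_zero] at hxh
      linarith [abs_nonneg x]
    have hh' : 0 < |h| := abs_pos.2 hh
    have hx2 : x ^ 2 ≤ 16 * h ^ 2 := by
      have : x ^ 2 ≤ (4 * h) ^ 2 := sq_le_sq.2 (by rw [abs_mul]; norm_num; exact hxh.le)
      linarith
    have hrh : r ^ 2 ≤ 33 * h ^ 2 := by linarith
    have hq : n ^ 4 / h ^ 2 ≤ 33 * ((n : ℝ) ^ 4 / r ^ 2) := by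
      rw [mul_div_assoc', div_le_div_iff₀ (by positivity) (by positivity)]
      have h4 : (0 : ℝ) ≤ n ^ 4 := by positivity
      nlinarith
    set m : ℝ := n ^ 2 / |h| with hm
    have hm0 : 0 ≤ m := by positivity
    have hm2 : m ^ 2 = n ^ 4 / h ^ 2 := by rw [hm, div_pow, sq_abs]; ring
    calc _ ≤ 16 * (2 + m) * (16 * (2 + m)) := by
          gcongr
          · exact waveSquareSum_nonneg _ _ _
          · exact waveSquareSum_le_of_height _ _ hh
          · exact waveSquareSum_le_of_height _ _ hh
      _ ≤ 256 * (8 + 2 * m ^ 2) := by nlinarith [sq_nonneg (m - 2)]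
      _ ≤ _ := by
          have : 0 ≤ (n : ℝ) ^ 4 / r ^ 2 := by positivity
          rw [hm2]
          linarith

/-- Fewer wave packets of the bush meet at a point the further it is from the centre. -/
lemma waveSquareSum_mul_le (n : ℕ) (x y h : ℝ) :
    waveSquareSum n x h * waveSquareSum n y h ≤
      200000 * (1 + n ^ 4 / (n ^ 2 + (x ^ 2 + y ^ 2 + h ^ 2))) := by
  rcases Nat.eq_zero_or_pos n with rfl | hn
  · have : (0 : ℝ) ≤ 0 ^ 4 / (0 ^ 2 + (x ^ 2 + y ^ 2 + h ^ 2)) := by positivity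
    simp [waveSquareSum]
  have hn' : (0 : ℝ) < n := by exact_mod_cast hn
  set r := √(x ^ 2 + y ^ 2 + h ^ 2) with hr
  have hr2 : r ^ 2 = x ^ 2 + y ^ 2 + h ^ 2 := Real.sq_sqrt (by positivity)
  rw [← hr2]
  have hr0 : 0 ≤ r := Real.sqrt_nonneg _
  rcases le_or_gt r n with hrn | hrn
  · calc _ ≤ (n : ℝ) * n := by
          gcongr
          · exact waveSquareSum_nonneg _ _ _
          · exact waveSquareSum_le _ _ _
          · exact waveSquareSum_le _ _ _
      _ ≤ 2 * (n ^ 4 / (n ^ 2 + r ^ 2)) := by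
          rw [mul_div_assoc', le_div_iff₀ (by positivity)]
          have : r ^ 2 ≤ n ^ 2 := by gcongr
          nlinarith [sq_nonneg (n : ℝ)]
      _ ≤ _ := by
          have : (0 : ℝ) ≤ n ^ 4 / (n ^ 2 + r ^ 2) := by positivity
          linarith
  · have hr' : 0 < r := hn'.trans hrn
    have hcomp : n ^ 4 / r ^ 2 ≤ 2 * ((n : ℝ) ^ 4 / (n ^ 2 + r ^ 2)) := by
      rw [mul_div_assoc', div_le_div_iff₀ (by positivity) (by positivity)]
      have : (n : ℝ) ^ 2 ≤ r ^ 2 := by gcongr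
      have h4 : (0 : ℝ) ≤ n ^ 4 := by positivity
      nlinarith
    have hmain : waveSquareSum n x h * waveSquareSum n y h ≤ 100000 * (1 + n ^ 4 / r ^ 2) := by
      rcases le_total |y| |x| with hyx | hyx
      · exact waveSquareSum_mul_le_of_far hrn hr2 hyx
      · rw [mul_comm]
        exact waveSquareSum_mul_le_of_far hrn (by rw [hr2]; ring) hyx
    linarith

/-! ### The extension operator, canonical squares and step functions. -/

@[fun_prop]
lemma continuous_lift : Continuous lift := by
  unfold lift
  refine (PiLp.continuous_toLp 2 _).comp (continuous_pi fun i => ?_)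
  fin_cases i <;> simp <;> fun_prop

lemma inner_space (u x : Space) : inner ℝ u x = u 0 * x 0 + u 1 * x 1 + u 2 * x 2 := by
  simp [PiLp.inner_apply, Fin.sum_univ_three]
  ring

lemma lift_zero (ξ : Plane) : lift ξ 0 = ξ 0 := rfl
lemma lift_one (ξ : Plane) : lift ξ 1 = ξ 1 := rfl
lemma lift_two (ξ : Plane) : lift ξ 2 = ξ 0 ^ 2 + ξ 1 ^ 2 := by
  have : lift ξ 2 = ‖ξ‖ ^ 2 := rfl
  rw [this, EuclideanSpace.real_norm_sq_eq, Fin.sum_univ_two]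

/-- The measure preserving identification of the frequency plane with `ℝ × ℝ`. -/
def planeEquiv : Plane ≃ᵐ ℝ × ℝ :=
  (MeasurableEquiv.toLp 2 (Fin 2 → ℝ)).symm.trans MeasurableEquiv.finTwoArrow

lemma planeEquiv_apply (ξ : Plane) : planeEquiv ξ = (ξ 0, ξ 1) := rfl

lemma measurePreserving_planeEquiv : MeasurePreserving planeEquiv :=
  (volume_preserving_finTwoArrow ℝ).comp
    (EuclideanSpace.volume_preserving_symm_measurableEquiv_toLp (Fin 2))

lemma canonicalSquare_eq_preimage (n : ℕ) (q : Fin n × Fin n) :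
    canonicalSquare n q = planeEquiv ⁻¹'
      (Set.Icc ((q.1 : ℝ) / n) (((q.1 : ℝ) + 1) / n) ×ˢ
        Set.Icc ((q.2 : ℝ) / n) (((q.2 : ℝ) + 1) / n)) := rfl

lemma measurableSet_canonicalSquare (n : ℕ) (q : Fin n × Fin n) :
    MeasurableSet (canonicalSquare n q) := by
  rw [canonicalSquare_eq_preimage]
  exact planeEquiv.measurable (measurableSet_Icc.prod measurableSet_Icc)

lemma volume_canonicalSquare (n : ℕ) (q : Fin n × Fin n) :
    volume (canonicalSquare n q) = ENNReal.ofReal ((n : ℝ) ^ 2)⁻¹ := by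
  rw [canonicalSquare_eq_preimage,
    measurePreserving_planeEquiv.measure_preimage_equiv, Measure.volume_eq_prod,
    Measure.prod_prod, Real.volume_Icc, Real.volume_Icc, ← ENNReal.ofReal_mul]
  · congr 1
    ring
  · rw [← sub_div, add_sub_cancel_left]
    positivity

lemma volume_planeLine (i : Fin 2) (a : ℝ) : volume {ξ : Plane | ξ i = a} = 0 := by
  have h := (EuclideanSpace.volume_preserving_symm_measurableEquiv_toLp
    (Fin 2)).measure_preimage_equiv {f | f i = a}
  rw [show (volume : Measure (Fin 2 → ℝ)) = Measure.pi fun _ => volume from rfl,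
    Measure.pi_hyperplane] at h
  exact h

lemma aedisjoint_interval {n : ℕ} {j k : ℕ} (hjk : j ≠ k) (i : Fin 2) :
    volume {ξ : Plane | ξ i ∈ Set.Icc ((j : ℝ) / n) (((j : ℝ) + 1) / n) ∧
      ξ i ∈ Set.Icc ((k : ℝ) / n) (((k : ℝ) + 1) / n)} = 0 := by
  wlog h : j < k generalizing j k
  · have := this hjk.symm (lt_of_le_of_ne (not_lt.1 h) hjk.symm)
    simpa only [and_comm] using this
  refine measure_mono_null ?_ (volume_planeLine i ((k : ℝ) / n))
  rintro ξ ⟨h1, h2⟩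
  refine le_antisymm (h1.2.trans ?_) h2.1
  have : (j : ℝ) + 1 ≤ k := by exact_mod_cast h
  gcongr

lemma volume_canonicalSquare_inter {n : ℕ} {q q' : Fin n × Fin n} (h : q ≠ q') :
    volume (canonicalSquare n q ∩ canonicalSquare n q') = 0 := by
  by_cases h1 : q.1 = q'.1
  · have h2 : (q.2 : ℕ) ≠ q'.2 := fun h2 => h (Prod.ext h1 (Fin.ext h2))
    refine measure_mono_null ?_ (aedisjoint_interval (n := n) h2 1)
    exact fun ξ hξ => ⟨hξ.1.2, hξ.2.2⟩
  · have h2 : (q.1 : ℕ) ≠ q'.1 := fun h2 => h1 (Fin.ext h2)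
    refine measure_mono_null ?_ (aedisjoint_interval (n := n) h2 0)
    exact fun ξ hξ => ⟨hξ.1.1, hξ.2.1⟩

lemma canonicalSquare_subset_unitSquare (n : ℕ) (q : Fin n × Fin n) :
    canonicalSquare n q ⊆ unitSquare := by
  have hsub : ∀ (j : Fin n) (t : ℝ), t ∈ Set.Icc ((j : ℝ) / n) (((j : ℝ) + 1) / n) →
      t ∈ Set.Icc (0 : ℝ) 1 := by
    intro j t ht
    have hn : (0 : ℝ) < n := by exact_mod_cast j.pos
    refine ⟨le_trans (by positivity) ht.1, ht.2.trans ?_⟩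
    rw [div_le_one hn]
    exact_mod_cast j.isLt
  intro ξ hξ i
  fin_cases i
  · exact hsub _ _ hξ.1
  · exact hsub _ _ hξ.2

lemma exists_mem_interval {n : ℕ} (hn : 1 ≤ n) {t : ℝ} (ht : t ∈ Set.Icc (0 : ℝ) 1) :
    ∃ j : Fin n, t ∈ Set.Icc ((j : ℝ) / n) (((j : ℝ) + 1) / n) := by
  have hn' : (0 : ℝ) < n := by exact_mod_cast hn
  rcases ht.2.lt_or_eq with h | h
  · have hlt : ⌊t * n⌋₊ < n := by
      rw [Nat.floor_lt (mul_nonneg ht.1 hn'.le)]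
      nlinarith
    refine ⟨⟨⌊t * n⌋₊, hlt⟩, ?_, ?_⟩
    · rw [div_le_iff₀ hn']
      exact Nat.floor_le (mul_nonneg ht.1 hn'.le)
    · rw [le_div_iff₀ hn']
      exact (Nat.lt_floor_add_one _).le
  · refine ⟨⟨n - 1, by omega⟩, ?_, ?_⟩
    · rw [div_le_iff₀ hn', h]
      simp
    · rw [le_div_iff₀ hn', h]
      push_cast [Nat.cast_sub hn]
      simp

lemma ensemble_univ {n : ℕ} (hn : 1 ≤ n) : ensemble n Finset.univ = unitSquare := by
  refine Set.Subset.antisymm ?_ ?_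
  · exact Set.iUnion₂_subset fun q _ => canonicalSquare_subset_unitSquare n q
  · intro ξ hξ
    obtain ⟨j, hj⟩ := exists_mem_interval hn (hξ 0)
    obtain ⟨i, hi⟩ := exists_mem_interval hn (hξ 1)
    exact Set.mem_iUnion₂.2 ⟨(j, i), Finset.mem_univ _, hj, hi⟩

lemma norm_integrand (F : Plane → ℂ) (x : Space) (ξ : Plane) :
    ‖F ξ * e (inner ℝ (lift ξ) x)‖ = ‖F ξ‖ := by
  rw [norm_mul, norm_e, mul_one]

lemma integrableOn_integrand {S : Set Plane} {F : Plane → ℂ} (hF : IntegrableOn F S) (x : Space) :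
    IntegrableOn (fun ξ => F ξ * e (inner ℝ (lift ξ) x)) S := by
  refine Integrable.mono hF (hF.aestronglyMeasurable.mul ?_) (Filter.Eventually.of_forall fun ξ => ?_)
  · exact (by fun_prop : Continuous fun ξ : Plane =>
      e (inner ℝ (lift ξ) x)).aestronglyMeasurable
  · rw [norm_integrand]

lemma continuous_ext {S : Set Plane} {F : Plane → ℂ} (hF : IntegrableOn F S) :
    Continuous (ext S F) := by
  unfold ext
  refine continuous_of_dominated (bound := fun ξ => ‖F ξ‖)
    (fun x => (integrableOn_integrand hF x).aestronglyMeasurable) (fun x => ?_) hF.norm ?_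
  · exact Filter.Eventually.of_forall fun ξ => (norm_integrand F x ξ).le
  · exact Filter.Eventually.of_forall fun ξ => by fun_prop

lemma norm_ext_le (S : Set Plane) (F : Plane → ℂ) (x : Space) :
    ‖ext S F x‖ ≤ ∫ ξ in S, ‖F ξ‖ := by
  refine (norm_integral_le_integral_norm _).trans (le_of_eq ?_)
  exact integral_congr_ae (Filter.Eventually.of_forall fun ξ => norm_integrand F x ξ)

/-- Translation in physical space leaves `|F|` unchanged, so that balls may be centred at the
origin. -/
lemma ext_modulate (S : Set Plane) (F : Plane → ℂ) (v x : Space) :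
    ext S (fun ξ => F ξ * e (inner ℝ (lift ξ) v)) x = ext S F (v + x) := by
  unfold ext
  congr 1
  ext ξ
  rw [inner_add_right, e_add, mul_assoc]

lemma ext_const_mul (S : Set Plane) (F : Plane → ℂ) (z : ℂ) (x : Space) :
    ext S (fun ξ => z * F ξ) x = z * ext S F x := by
  unfold ext
  rw [← integral_const_mul]
  simp only [mul_assoc]

lemma ext_ensemble {n : ℕ} {F : Plane → ℂ} (hF : IntegrableOn F unitSquare)
    (A : Finset (Fin n × Fin n)) (x : Space) :
    ext (ensemble n A) F x = ∑ q ∈ A, ext (canonicalSquare n q) F x := by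
  have hU : ensemble n A = ⋃ q : A, canonicalSquare n q := by
    unfold ensemble
    rw [Set.iUnion_subtype]
  have hsub : ensemble n A ⊆ unitSquare :=
    Set.iUnion₂_subset fun q _ => canonicalSquare_subset_unitSquare n q
  unfold ext
  rw [hU, integral_iUnion_ae (fun q : A => (measurableSet_canonicalSquare n q).nullMeasurableSet)
    (fun q q' h => volume_canonicalSquare_inter (n := n) fun h' => h (Subtype.ext h'))
    (integrableOn_integrand (hF.mono_set (hU.symm.subset.trans hsub)) x), tsum_fintype]
  exact Finset.sum_coe_sort A fun q => ∫ ξ in canonicalSquare n q, F ξ * e (inner ℝ (lift ξ) x)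

lemma ext_unitSquare {n : ℕ} (hn : 1 ≤ n) {F : Plane → ℂ} (hF : IntegrableOn F unitSquare)
    (x : Space) : ext unitSquare F x = ∑ q, ext (canonicalSquare n q) F x := by
  rw [← ensemble_univ hn, ext_ensemble hF]

/-- The function equal to `n² b q` on the canonical square `q`. -/
def stepFun (n : ℕ) (b : Fin n × Fin n → ℂ) (ξ : Plane) : ℂ :=
  ∑ q, (canonicalSquare n q).indicator (fun _ => (n : ℂ) ^ 2 * b q) ξ

lemma integrable_stepFun (n : ℕ) (b : Fin n × Fin n → ℂ) : Integrable (stepFun n b) := by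
  unfold stepFun
  refine integrable_finsetSum _ fun q _ => ?_
  rw [integrable_indicator_iff (measurableSet_canonicalSquare n q)]
  refine integrableOn_const ?_
  rw [volume_canonicalSquare]
  exact ENNReal.ofReal_ne_top

/-- The squares are closed and the indicators add up on common edges, hence only almost everywhere.
-/
lemma stepFun_ae_eq (n : ℕ) (b : Fin n × Fin n → ℂ) (q : Fin n × Fin n) :
    ∀ᵐ ξ ∂(volume.restrict (canonicalSquare n q)), stepFun n b ξ = (n : ℂ) ^ 2 * b q := by
  have h : ∀ q' ∈ Finset.univ.erase q,
      ∀ᵐ ξ ∂(volume.restrict (canonicalSquare n q)), ξ ∉ canonicalSquare n q' := by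
    intro q' hq'
    rw [ae_iff, Measure.restrict_apply' (measurableSet_canonicalSquare n q)]
    simp only [not_not, Set.ofPred_mem_eq]
    exact volume_canonicalSquare_inter (Finset.ne_of_mem_erase hq')
  filter_upwards [(Finset.eventually_all _).2 h,
    ae_restrict_mem (measurableSet_canonicalSquare n q)] with ξ h1 h2
  unfold stepFun
  rw [Finset.sum_eq_single q, Set.indicator_of_mem h2]
  · intro q' _ hq'
    exact Set.indicator_of_notMem (h1 q' (Finset.mem_erase.2 ⟨hq', Finset.mem_univ _⟩)) _
  · simp

/-- The paraboloid phase separates in the two frequency coordinates, and the height `n²` of the step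
function gives each one-dimensional wave its normalizing factor `n`. -/
lemma ext_canonicalSquare_stepFun (n : ℕ) (b : Fin n × Fin n → ℂ) (q : Fin n × Fin n) (x : Space) :
    ext (canonicalSquare n q) (stepFun n b) x =
      b q * ((n * intervalWave n q.1 (x 0) (x 2)) * (n * intervalWave n q.2 (x 1) (x 2))) := by
  have h1 : ext (canonicalSquare n q) (stepFun n b) x =
      ∫ ξ in canonicalSquare n q, (fun z : ℝ × ℝ => (n : ℂ) ^ 2 * b q *
        (e (z.1 * x 0 + z.1 ^ 2 * x 2) * e (z.2 * x 1 + z.2 ^ 2 * x 2))) (planeEquiv ξ) := by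
    unfold ext
    refine integral_congr_ae ?_
    filter_upwards [stepFun_ae_eq n b q] with ξ hξ
    rw [hξ, planeEquiv_apply, ← e_add, inner_space, lift_zero, lift_one, lift_two]
    congr 2
    ring
  have hle : ∀ j : Fin n, (j : ℝ) / n ≤ ((j : ℝ) + 1) / n := fun j => by gcongr; linarith
  rw [h1, canonicalSquare_eq_preimage]
  refine (measurePreserving_planeEquiv.setIntegral_preimage_emb
    planeEquiv.measurableEmbedding (fun z : ℝ × ℝ => (n : ℂ) ^ 2 * b q *
      (e (z.1 * x 0 + z.1 ^ 2 * x 2) * e (z.2 * x 1 + z.2 ^ 2 * x 2))) _).trans ?_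
  rw [integral_const_mul, Measure.volume_eq_prod,
    setIntegral_prod_mul (fun t : ℝ => e (t * x 0 + t ^ 2 * x 2))
      (fun t : ℝ => e (t * x 1 + t ^ 2 * x 2)),
    integral_Icc_eq_integral_Ioc, integral_Icc_eq_integral_Ioc,
    ← intervalIntegral.integral_of_le (hle _), ← intervalIntegral.integral_of_le (hle _)]
  unfold intervalWave
  ring

lemma norm_ext_canonicalSquare_stepFun_le_one {n : ℕ} {b : Fin n × Fin n → ℂ} (hb : ∀ q, ‖b q‖ ≤ 1)
    (q : Fin n × Fin n) (x : Space) : ‖ext (canonicalSquare n q) (stepFun n b) x‖ ≤ 1 := by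
  rw [ext_canonicalSquare_stepFun, norm_mul, norm_mul, norm_mul, norm_mul, Complex.norm_natCast]
  have h1 := natCast_mul_norm_intervalWave_le_one n q.1 (x 0) (x 2)
  have h2 := natCast_mul_norm_intervalWave_le_one n q.2 (x 1) (x 2)
  exact mul_le_one₀ (hb q) (by positivity) (mul_le_one₀ h1 (by positivity) h2)

/-- The square function of the bush of wave packets carried by a step function. -/
lemma sum_norm_ext_stepFun_sq_le {n : ℕ} {b : Fin n × Fin n → ℂ} (hb : ∀ q, ‖b q‖ ≤ 1)
    (x : Space) : ∑ q, ‖ext (canonicalSquare n q) (stepFun n b) x‖ ^ 2 ≤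
      200000 * (1 + n ^ 4 / (n ^ 2 + ‖x‖ ^ 2)) := by
  have h := waveSquareSum_mul_le n (x 0) (x 1) (x 2)
  have hx : ‖x‖ ^ 2 = x 0 ^ 2 + x 1 ^ 2 + x 2 ^ 2 := by
    rw [EuclideanSpace.real_norm_sq_eq, Fin.sum_univ_three]
  rw [hx]
  refine le_trans ?_ h
  unfold waveSquareSum
  rw [Finset.sum_mul_sum, Finset.sum_range, Fintype.sum_prod_type]
  refine Finset.sum_le_sum fun j _ => ?_
  rw [Finset.sum_range]
  refine Finset.sum_le_sum fun i _ => ?_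
  rw [ext_canonicalSquare_stepFun, norm_mul, norm_mul, norm_mul, norm_mul, Complex.norm_natCast,
    mul_pow, mul_pow _ _ 2]
  exact mul_le_of_le_one_left (by positivity) (pow_le_one₀ (norm_nonneg _) (hb _))

/-! ### Moments of sums of independent variables, with sums over all outcomes in place of
expectations. -/

lemma sum_fin_cons {α A : Type*} [Fintype α] [AddCommMonoid A] {M : ℕ}
    (f : (Fin (M + 1) → α) → A) :
    ∑ s, f s = ∑ s' : Fin M → α, ∑ t, f (Fin.cons t s') := by
  rw [← (Fin.consEquiv fun _ : Fin (M + 1) => α).sum_comp, Fintype.sum_prod_type, Finset.sum_comm]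
  rfl

lemma sum_independent_eq_zero {α E : Type*} [Fintype α] [AddCommGroup E] {M : ℕ} {Y : Fin M → α → E} (hY : ∀ g, ∑ t, Y g t = 0) :
    ∑ s : Fin M → α, ∑ g, Y g (s g) = 0 := by
  induction M with
  | zero => simp
  | succ M ih =>
    rw [sum_fin_cons]
    simp [Fin.sum_univ_succ, Finset.sum_add_distrib, hY, ← Finset.smul_sum, ih fun g => hY g.succ]

section Moments

variable {E : Type*} [NormedAddCommGroup E] [InnerProductSpace ℝ E]
variable {α β : Type*} [Fintype α] [Fintype β]

lemma sum_sum_inner_eq_zero {x : α → E} {y : β → E} (hy : ∑ t, y t = 0) :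
    ∑ s, ∑ t, inner ℝ (x s) (y t) = 0 := by
  simp [← inner_sum, hy]

lemma sum_sum_inner_eq_zero' {x : α → E} {y : β → E} (hx : ∑ s, x s = 0) :
    ∑ s, ∑ t, inner ℝ (x s) (y t) = 0 := by
  rw [Finset.sum_comm]
  simp [← sum_inner, hx]

lemma sum_sum_norm_add_sq {x : α → E} {y : β → E} (hy : ∑ t, y t = 0) :
    ∑ s, ∑ t, ‖x s + y t‖ ^ 2 =
      Fintype.card β * ∑ s, ‖x s‖ ^ 2 + Fintype.card α * ∑ t, ‖y t‖ ^ 2 := by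
  simp_rw [norm_add_sq_real, Finset.sum_add_distrib, ← Finset.mul_sum]
  rw [sum_sum_inner_eq_zero hy]
  simp [Finset.mul_sum]

/-- In the expansion of the fourth power, the terms of degree one in `x` or in `y` vanish on
summation because both families are centred. The mixed terms `2 |x|²|y|² + 4 ⟨x, y⟩²` give the 6 by
Cauchy–Schwarz. -/
lemma sum_sum_norm_add_pow_four_le {x : α → E} {y : β → E} (hx : ∑ s, x s = 0)
    (hy : ∑ t, y t = 0) :
    ∑ s, ∑ t, ‖x s + y t‖ ^ 4 ≤ Fintype.card β * ∑ s, ‖x s‖ ^ 4 +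
      6 * (∑ s, ‖x s‖ ^ 2) * (∑ t, ‖y t‖ ^ 2) + Fintype.card α * ∑ t, ‖y t‖ ^ 4 := by
  have hpt : ∀ s t, ‖x s + y t‖ ^ 4 ≤ (‖x s‖ ^ 4 + 6 * (‖x s‖ ^ 2 * ‖y t‖ ^ 2) + ‖y t‖ ^ 4) +
      (4 * inner ℝ (‖x s‖ ^ 2 • x s) (y t) + 4 * inner ℝ (x s) (‖y t‖ ^ 2 • y t)) := by
    intro s t
    have h1 : ‖x s + y t‖ ^ 4 = (‖x s + y t‖ ^ 2) ^ 2 := by ring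
    rw [h1, norm_add_sq_real, real_inner_smul_left, real_inner_smul_right]
    have h2 := abs_real_inner_le_norm (x s) (y t)
    have h3 : inner ℝ (x s) (y t) ^ 2 ≤ (‖x s‖ * ‖y t‖) ^ 2 := sq_le_sq.2 (by
      rwa [abs_of_nonneg (mul_nonneg (norm_nonneg (x s)) (norm_nonneg (y t)))])
    nlinarith
  refine (Finset.sum_le_sum fun s _ => Finset.sum_le_sum fun t _ => hpt s t).trans (le_of_eq ?_)
  have e1 := sum_sum_inner_eq_zero (x := fun s => ‖x s‖ ^ 2 • x s) hy
  have e2 := sum_sum_inner_eq_zero' (y := fun t => ‖y t‖ ^ 2 • y t) hx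
  simp_rw [Finset.sum_add_distrib, ← Finset.mul_sum]
  simp only [e1, e2]
  simp only [Finset.sum_const, Finset.card_univ, nsmul_eq_mul, ← Finset.mul_sum, ← Finset.sum_mul]
  ring

lemma sum_norm_independent_sq {M : ℕ} {Y : Fin M → α → E} (hY : ∀ g, ∑ t, Y g t = 0) :
    Fintype.card α * ∑ s : Fin M → α, ‖∑ g, Y g (s g)‖ ^ 2 =
      Fintype.card α ^ M * ∑ g, ∑ t, ‖Y g t‖ ^ 2 := by
  induction M with
  | zero => simp
  | succ M ih =>
    rw [sum_fin_cons]
    simp only [Fin.sum_univ_succ, Fin.cons_zero, Fin.cons_succ]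
    simp_rw [add_comm (Y 0 _)]
    rw [sum_sum_norm_add_sq (x := fun s' : Fin M → α => ∑ g : Fin M, Y g.succ (s' g)) (hY 0),
      mul_add, mul_left_comm, ih fun g => hY g.succ]
    simp
    ring

/-- Rosenthal's inequality for the fourth moment of a sum of independent centred variables. -/
lemma sum_norm_independent_pow_four_le {M : ℕ} {Y : Fin M → α → E} (hY : ∀ g, ∑ t, Y g t = 0) :
    (Fintype.card α : ℝ) ^ 2 * ∑ s : Fin M → α, ‖∑ g, Y g (s g)‖ ^ 4 ≤
      Fintype.card α ^ M * (3 * (∑ g, ∑ t, ‖Y g t‖ ^ 2) ^ 2 +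
        Fintype.card α * ∑ g, ∑ t, ‖Y g t‖ ^ 4) := by
  induction M with
  | zero => simp
  | succ M ih =>
    rw [sum_fin_cons]
    simp only [Fin.sum_univ_succ, Fin.cons_zero, Fin.cons_succ]
    simp_rw [add_comm (Y 0 _)]
    have h4 := sum_sum_norm_add_pow_four_le
      (x := fun s' : Fin M → α => ∑ g : Fin M, Y g.succ (s' g))
      (sum_independent_eq_zero fun g => hY g.succ) (hY 0)
    have h2 := sum_norm_independent_sq fun g => hY (Fin.succ g)
    have hi := ih fun g => hY (Fin.succ g)
    simp only [Fintype.card_fun, Fintype.card_fin, Nat.cast_pow] at h4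
    generalize ∑ s' : Fin M → α, ∑ t, ‖∑ g : Fin M, Y g.succ (s' g) + Y 0 t‖ ^ 4 = A at h4 ⊢
    generalize ∑ s' : Fin M → α, ‖∑ g : Fin M, Y g.succ (s' g)‖ ^ 4 = B at h4 hi
    generalize ∑ s' : Fin M → α, ‖∑ g : Fin M, Y g.succ (s' g)‖ ^ 2 = C at h4 h2
    generalize ∑ g : Fin M, ∑ t, ‖Y g.succ t‖ ^ 2 = V at *
    generalize ∑ g : Fin M, ∑ t, ‖Y g.succ t‖ ^ 4 = W at *
    have hv0 : 0 ≤ ∑ t, ‖Y 0 t‖ ^ 2 := Finset.sum_nonneg fun _ _ => by positivity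
    generalize ∑ t, ‖Y 0 t‖ ^ 2 = v at *
    generalize ∑ t, ‖Y 0 t‖ ^ 4 = w at *
    have hN : (0 : ℝ) ≤ Fintype.card α := by positivity
    generalize (Fintype.card α : ℝ) = N at *
    have hNM : 0 ≤ N ^ M := by positivity
    calc N ^ 2 * A ≤ N ^ 2 * (N * B + 6 * C * v + N ^ M * w) := by gcongr
      _ = N * (N ^ 2 * B) + 6 * N * (N * C) * v + N ^ 2 * N ^ M * w := by ring
      _ ≤ N * (N ^ M * (3 * V ^ 2 + N * W)) + 6 * N * (N ^ M * V) * v + N ^ 2 * N ^ M * w := by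
          rw [h2]
          gcongr
      -- The mixed term `6 V v` is exactly the cross term of `3 (v + V)²`; this is what fixes the
      -- constant 3.
      _ ≤ N ^ (M + 1) * (3 * (v + V) ^ 2 + N * (w + W)) := by
          have : 0 ≤ N ^ M * N * (3 * v ^ 2) := by positivity
          rw [pow_succ N M]
          linarith

end Moments

/-- The first term suffices for `x ≤ l` and the second for `x ≥ l`; the scale `l` is left free for
optimization. -/
lemma rpow_le_sq_add_pow_four {p x l : ℝ} (hp : 2 ≤ p) (hp' : p ≤ 4) (hx : 0 ≤ x) (hl : 0 < l) :
    x ^ p ≤ l ^ (p - 2) * x ^ 2 + l ^ (p - 4) * x ^ 4 := by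
  rcases hx.eq_or_lt with rfl | hx
  · rw [Real.zero_rpow (by linarith)]
    simp
  have h2 : x ^ p = x ^ (p - 2) * x ^ 2 := by
    rw [← Real.rpow_natCast x 2, ← Real.rpow_add hx]
    congr 1
    push_cast
    ring
  have h4 : x ^ p = x ^ (p - 4) * x ^ 4 := by
    rw [← Real.rpow_natCast x 4, ← Real.rpow_add hx]
    congr 1
    push_cast
    ring
  rcases le_total x l with h | h
  · have : x ^ (p - 2) ≤ l ^ (p - 2) := Real.rpow_le_rpow hx.le h (by linarith)
    calc x ^ p = x ^ (p - 2) * x ^ 2 := h2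
      _ ≤ l ^ (p - 2) * x ^ 2 := by gcongr
      _ ≤ _ := le_add_of_nonneg_right (by positivity)
  · have : x ^ (p - 4) ≤ l ^ (p - 4) := Real.rpow_le_rpow_of_nonpos hl h (by linarith)
    calc x ^ p = x ^ (p - 4) * x ^ 4 := h4
      _ ≤ l ^ (p - 4) * x ^ 4 := by gcongr
      _ ≤ _ := le_add_of_nonneg_left (by positivity)

lemma add_rpow_le_two_rpow_mul {p x y : ℝ} (hp : 1 ≤ p) (hx : 0 ≤ x) (hy : 0 ≤ y) :
    (x + y) ^ p ≤ 2 ^ p * (x ^ p + y ^ p) := by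
  wlog h : x ≤ y generalizing x y
  · rw [add_comm x, add_comm (x ^ p)]
    exact this hy hx (le_of_not_ge h)
  calc (x + y) ^ p ≤ (2 * y) ^ p := by gcongr; linarith
    _ = 2 ^ p * y ^ p := Real.mul_rpow (by norm_num) hy
    _ ≤ _ := by
      gcongr
      exact le_add_of_nonneg_left (by positivity)

lemma norm_sub_pow_four_le {z w : ℂ} : ‖z - w‖ ^ 4 ≤ 8 * (‖z‖ ^ 4 + ‖w‖ ^ 4) := by
  have h := norm_sub_le z w
  calc ‖z - w‖ ^ 4 ≤ (‖z‖ + ‖w‖) ^ 4 := by gcongr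
    _ ≤ 2 ^ (4 - 1) * (‖z‖ ^ 4 + ‖w‖ ^ 4) := add_pow_le (norm_nonneg _) (norm_nonneg _) 4
    _ = _ := by norm_num

/-- The `p`-th moment, `2 ≤ p ≤ 4`, of a sum in which one bounded term is drawn from each group. -/
lemma sum_norm_random_choice_rpow_le {G : Type*} [Fintype G] [Nonempty G] {M : ℕ} {p : ℝ}
    (hp : 2 ≤ p) (hp' : p ≤ 4) {a : Fin M → G → ℂ} (ha : ∀ g t, ‖a g t‖ ≤ 1) {V : ℝ}
    (hV : V = (Fintype.card G : ℝ)⁻¹ * ∑ g, ∑ t, ‖a g t‖ ^ 2) :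
    ∑ s : Fin M → G, ‖∑ g, a g (s g)‖ ^ p ≤ (Fintype.card G : ℝ) ^ M * (2 ^ p *
      (((Fintype.card G : ℝ)⁻¹ * ‖∑ g, ∑ t, a g t‖) ^ p + 20 * (V ^ (p / 2) + V))) := by
  set N : ℝ := (Fintype.card G : ℝ) with hN
  have hN0 : 0 < N := by simpa [hN] using Fintype.card_pos
  have hNC : (Fintype.card G : ℂ) = (N : ℂ) := by simp [hN]
  have hNC0 : (N : ℂ) ≠ 0 := by exact_mod_cast hN0.ne'
  set μ : Fin M → ℂ := fun g => (N : ℂ)⁻¹ * ∑ t, a g t with hμ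
  set Y : Fin M → G → ℂ := fun g t => a g t - μ g with hYdef
  have hsumμ : ∀ g, ∑ t, a g t = N * μ g := fun g => by
    rw [hμ]; field_simp
  have hY : ∀ g, ∑ t, Y g t = 0 := fun g => by
    simp [hYdef, Finset.sum_sub_distrib, hsumμ, hNC]
  have hV0 : 0 ≤ V := by
    rw [hV]; positivity
  have hsumV : ∑ g, ∑ t, ‖a g t‖ ^ 2 = N * V := by rw [hV]; field_simp
  -- second moments
  have hY2 : ∀ g, ∑ t, ‖Y g t‖ ^ 2 ≤ ∑ t, ‖a g t‖ ^ 2 := by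
    intro g
    -- Pythagoras for `a = μ + Y`, the mean being regarded as a family with one member.
    have hx := sum_sum_norm_add_sq (x := fun _ : Unit => μ g) (hY g)
    simp only [hYdef, add_sub_cancel, Finset.univ_unique, Finset.sum_const, Finset.card_singleton,
      one_smul, Fintype.card_unit, Nat.cast_one, one_mul] at hx
    rw [hx]
    exact le_add_of_nonneg_left (by positivity)
  have hμ1 : ∀ g, ‖μ g‖ ^ 2 * N ≤ ∑ t, ‖a g t‖ ^ 2 := by
    intro g
    have hx := sum_sum_norm_add_sq (x := fun _ : Unit => μ g) (hY g)
    simp only [hYdef, add_sub_cancel, Finset.univ_unique, Finset.sum_const, Finset.card_singleton,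
      one_smul, Fintype.card_unit, Nat.cast_one, one_mul] at hx
    rw [hx, mul_comm]
    exact le_add_of_nonneg_right (Finset.sum_nonneg fun _ _ => by positivity)
  have hμle : ∀ g, ‖μ g‖ ≤ 1 := by
    intro g
    have h1 : ∑ t, ‖a g t‖ ^ 2 ≤ N := by
      calc ∑ t, ‖a g t‖ ^ 2 ≤ ∑ t : G, (1 : ℝ) :=
            Finset.sum_le_sum fun t _ => pow_le_one₀ (norm_nonneg _) (ha g t)
        _ = N := by simp [hN]
    have h2 : ‖μ g‖ ^ 2 ≤ 1 := by
      by_contra! h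
      nlinarith [hμ1 g]
    exact (sq_le_one_iff₀ (norm_nonneg _)).1 h2
  have hpow : ∀ z : ℂ, ‖z‖ ≤ 1 → ‖z‖ ^ 4 ≤ ‖z‖ ^ 2 := fun z hz =>
    pow_le_pow_of_le_one (norm_nonneg z) hz (by norm_num)
  have hY4 : ∀ g, ∑ t, ‖Y g t‖ ^ 4 ≤ 16 * ∑ t, ‖a g t‖ ^ 2 := by
    intro g
    calc ∑ t, ‖Y g t‖ ^ 4 ≤ ∑ t, (8 * ‖a g t‖ ^ 2 + 8 * ‖μ g‖ ^ 2) := by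
          refine Finset.sum_le_sum fun t _ => ?_
          have h1 := norm_sub_pow_four_le (z := a g t) (w := μ g)
          have h2 := hpow _ (ha g t)
          have h3 := hpow _ (hμle g)
          linarith
      _ = 8 * ∑ t, ‖a g t‖ ^ 2 + 8 * (‖μ g‖ ^ 2 * N) := by
          rw [Finset.sum_add_distrib, ← Finset.mul_sum]
          simp [hN]
          ring
      _ ≤ _ := by linarith [hμ1 g]
  set S : (Fin M → G) → ℂ := fun s => ∑ g, Y g (s g) with hS
  have hS2 : ∑ s, ‖S s‖ ^ 2 ≤ N ^ M * V := by
    have h1 := sum_norm_independent_sq hY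
    have h2 : ∑ g, ∑ t, ‖Y g t‖ ^ 2 ≤ N * V := hsumV ▸ Finset.sum_le_sum fun g _ => hY2 g
    have h3 : N * ∑ s, ‖S s‖ ^ 2 ≤ N * (N ^ M * V) := by
      calc _ = _ := h1
        _ ≤ N ^ M * (N * V) := by gcongr
        _ = _ := by ring
    exact le_of_mul_le_mul_left h3 hN0
  have hS4 : ∑ s, ‖S s‖ ^ 4 ≤ N ^ M * (3 * V ^ 2 + 16 * V) := by
    have h1 := sum_norm_independent_pow_four_le hY
    have h2 : ∑ g, ∑ t, ‖Y g t‖ ^ 2 ≤ N * V := hsumV ▸ Finset.sum_le_sum fun g _ => hY2 g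
    have h3 : ∑ g, ∑ t, ‖Y g t‖ ^ 4 ≤ 16 * (N * V) := by
      rw [← hsumV, Finset.mul_sum]
      exact Finset.sum_le_sum fun g _ => hY4 g
    have h4 : 0 ≤ ∑ g, ∑ t, ‖Y g t‖ ^ 2 := by positivity
    have h5 : N ^ 2 * ∑ s, ‖S s‖ ^ 4 ≤ N ^ 2 * (N ^ M * (3 * V ^ 2 + 16 * V)) := by
      calc _ ≤ _ := h1
        _ ≤ N ^ M * (3 * (N * V) ^ 2 + N * (16 * (N * V))) := by gcongr
        _ = _ := by ring
    exact le_of_mul_le_mul_left h5 (by positivity)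
  -- interpolation
  have hSp : ∑ s, ‖S s‖ ^ p ≤ N ^ M * (20 * (V ^ (p / 2) + V)) := by
    -- This scale balances the second moment `V` against the fourth moment, which is at most `16 V
    -- (V + 1)`; the added 1 keeps `l` positive when `V = 0`.
    set l : ℝ := √(V + 1) with hl
    have hl0 : 0 < l := Real.sqrt_pos.2 (by linarith)
    have hl2 : l ^ 2 = V + 1 := Real.sq_sqrt (by linarith)
    have hl4 : l ^ (p - 2) = l ^ (p - 4) * (V + 1) := by
      rw [← hl2, ← Real.rpow_natCast l 2, ← Real.rpow_add hl0]
      congr 1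
      push_cast
      ring
    have hlp : l ^ (p - 2) ≤ V ^ (p / 2 - 1) + 1 := by
      have : l ^ (p - 2) = (V + 1) ^ (p / 2 - 1) := by
        rw [hl, Real.sqrt_eq_rpow, ← Real.rpow_mul (by linarith)]
        congr 1
        ring
      rw [this]
      have := Real.rpow_add_le_add_rpow hV0 zero_le_one (p := p / 2 - 1) (by linarith) (by linarith)
      rwa [Real.one_rpow] at this
    have hVp : V ^ (p / 2 - 1) * V ≤ V ^ (p / 2) := by
      rcases hV0.eq_or_lt with h | h
      · rw [← h, mul_zero]
        positivity
      · rw [← Real.rpow_add_one h.ne']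
        simp
    calc ∑ s, ‖S s‖ ^ p ≤ ∑ s, (l ^ (p - 2) * ‖S s‖ ^ 2 + l ^ (p - 4) * ‖S s‖ ^ 4) :=
          Finset.sum_le_sum fun s _ => rpow_le_sq_add_pow_four hp hp' (norm_nonneg _) hl0
      _ = l ^ (p - 2) * ∑ s, ‖S s‖ ^ 2 + l ^ (p - 4) * ∑ s, ‖S s‖ ^ 4 := by
          rw [Finset.sum_add_distrib, Finset.mul_sum, Finset.mul_sum]
      _ ≤ l ^ (p - 2) * (N ^ M * V) + l ^ (p - 4) * (N ^ M * (3 * V ^ 2 + 16 * V)) := by gcongr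
      _ ≤ l ^ (p - 2) * (N ^ M * V) + l ^ (p - 4) * (N ^ M * (16 * (V * (V + 1)))) := by
          gcongr
          nlinarith
      _ = N ^ M * (17 * (l ^ (p - 2) * V)) := by rw [hl4]; ring
      _ ≤ N ^ M * (17 * ((V ^ (p / 2 - 1) + 1) * V)) := by gcongr
      _ ≤ _ := by
          gcongr ?_ * ?_
          have : 0 ≤ V ^ (p / 2) := by positivity
          nlinarith
  have hdecomp : ∀ s : Fin M → G, ∑ g, a g (s g) = ∑ g, μ g + S s := fun s => by
    rw [hS, ← Finset.sum_add_distrib]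
    simp [hYdef]
  have hmean : ‖∑ g, μ g‖ = N⁻¹ * ‖∑ g, ∑ t, a g t‖ := by
    rw [hμ, ← Finset.mul_sum, norm_mul, norm_inv, Complex.norm_real, Real.norm_of_nonneg hN0.le]
  calc ∑ s : Fin M → G, ‖∑ g, a g (s g)‖ ^ p
      ≤ ∑ s, 2 ^ p * (‖∑ g, μ g‖ ^ p + ‖S s‖ ^ p) := by
        refine Finset.sum_le_sum fun s _ => ?_
        rw [hdecomp]
        refine le_trans ?_ (add_rpow_le_two_rpow_mul (by linarith) (norm_nonneg _) (norm_nonneg _))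
        exact Real.rpow_le_rpow (norm_nonneg _) (norm_add_le _ _) (by linarith)
    _ = 2 ^ p * (N ^ M * ‖∑ g, μ g‖ ^ p + ∑ s, ‖S s‖ ^ p) := by
        rw [← Finset.mul_sum, Finset.sum_add_distrib]
        simp [hN]
    _ ≤ 2 ^ p * (N ^ M * ‖∑ g, μ g‖ ^ p + N ^ M * (20 * (V ^ (p / 2) + V))) := by gcongr
    _ = _ := by rw [hmean]; ring

/-! ### Weights adapted to balls. -/

lemma ballWeight_pos {κ : ℝ} (c : Space) {r : ℝ} (hr : 0 < r) (x : Space) :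
    0 < ballWeight κ c r x := by
  unfold ballWeight
  positivity

lemma ballWeight_le_one {κ : ℝ} (hκ : 0 ≤ κ) (c : Space) {r : ℝ} (hr : 0 < r) (x : Space) :
    ballWeight κ c r x ≤ 1 := by
  unfold ballWeight
  refine Real.rpow_le_one_of_one_le_of_nonpos ?_ (by linarith)
  have : 0 ≤ ‖x - c‖ / r := by positivity
  linarith

lemma continuous_ballWeight (κ : ℝ) (c : Space) {r : ℝ} (hr : 0 < r) :
    Continuous (ballWeight κ c r) := by
  unfold ballWeight
  refine Continuous.rpow_const (by fun_prop) fun x => Or.inl ?_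
  positivity

/-- The total mass of the weight adapted to the unit ball. -/
def weightMass (κ : ℝ) : ℝ := ∫ x : Space, (1 + ‖x‖) ^ (-κ)

lemma weightMass_nonneg (κ : ℝ) : 0 ≤ weightMass κ :=
  integral_nonneg fun _ => by positivity

lemma integrable_unit_weight {κ : ℝ} (hκ : 3 < κ) :
    Integrable (fun x : Space => (1 + ‖x‖) ^ (-κ)) :=
  integrable_one_add_norm (by simpa using hκ)

lemma ballWeight_eq {κ : ℝ} (c : Space) {r : ℝ} (hr : 0 < r) (x : Space) :
    ballWeight κ c r x = (fun y : Space => (1 + ‖y‖) ^ (-κ)) (r⁻¹ • (x - c)) := by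
  simp only [ballWeight, norm_smul, norm_inv, Real.norm_of_nonneg hr.le]
  rw [div_eq_inv_mul]

lemma integrable_ballWeight {κ : ℝ} (hκ : 3 < κ) (c : Space) {r : ℝ} (hr : 0 < r) :
    Integrable (ballWeight κ c r) := by
  have h := ((integrable_unit_weight hκ).comp_smul (inv_ne_zero hr.ne')).comp_sub_right c
  exact h.congr (Filter.Eventually.of_forall fun x => (ballWeight_eq c hr x).symm)

lemma integral_ballWeight {κ : ℝ} (c : Space) {r : ℝ} (hr : 0 < r) :
    ∫ x, ballWeight κ c r x = r ^ 3 * weightMass κ := by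
  simp_rw [ballWeight_eq c hr]
  rw [integral_sub_right_eq_self (fun x : Space => (fun y : Space => (1 + ‖y‖) ^ (-κ)) (r⁻¹ • x)) c,
    Measure.integral_comp_smul volume (fun y : Space => (1 + ‖y‖) ^ (-κ))]
  simp [weightMass, abs_of_pos hr]

lemma ballWeight_le_of_mem_ball {κ : ℝ} (hκ : 0 ≤ κ) (c : Space) {r : ℝ} (hr : 0 < r) {x z : Space}
    (hz : z ∈ Metric.ball x r) : ballWeight κ c r x ≤ 2 ^ κ * ballWeight κ c r z := by
  unfold ballWeight
  have h1 : ‖z - c‖ ≤ ‖x - c‖ + r := by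
    have := norm_add_le (z - x) (x - c)
    rw [sub_add_sub_cancel] at this
    have h2 : ‖z - x‖ < r := by rwa [Metric.mem_ball, dist_eq_norm] at hz
    linarith
  have h3 : 1 + ‖z - c‖ / r ≤ 2 * (1 + ‖x - c‖ / r) := by
    have : ‖z - c‖ / r ≤ (‖x - c‖ + r) / r := by gcongr
    rw [add_div, div_self hr.ne'] at this
    have : 0 ≤ ‖x - c‖ / r := by positivity
    linarith
  have hx : 0 < 1 + ‖x - c‖ / r := by positivity
  have hz' : 0 < 1 + ‖z - c‖ / r := by positivity
  calc (1 + ‖x - c‖ / r) ^ (-κ) = 2 ^ κ * (2 * (1 + ‖x - c‖ / r)) ^ (-κ) := by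
        rw [Real.mul_rpow (by norm_num) hx.le, ← mul_assoc, ← Real.rpow_add (by norm_num)]
        simp
    _ ≤ _ := by
        gcongr ?_ * ?_
        exact Real.rpow_le_rpow_of_nonpos hz' h3 (by linarith)

/-- The mass of the unit ball. -/
def unitBallVolume : ℝ := (volume (Metric.ball (0 : Space) 1)).toReal

lemma unitBallVolume_pos : 0 < unitBallVolume :=
  ENNReal.toReal_pos (Metric.measure_ball_pos volume _ one_pos).ne' measure_ball_lt_top.ne

lemma volume_ball_eq (c : Space) {r : ℝ} (hr : 0 ≤ r) :
    volume (Metric.ball c r) = ENNReal.ofReal (r ^ 3 * unitBallVolume) := by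
  rw [Measure.addHaar_ball volume c hr, unitBallVolume, ENNReal.ofReal_mul (by positivity),
    ENNReal.ofReal_toReal measure_ball_lt_top.ne]
  simp

/-- The constant in the comparison of a weighted integral with the integrals over balls. -/
def weightConst (κ : ℝ) : ℝ := 2 ^ κ * weightMass κ / unitBallVolume

lemma weightConst_nonneg (κ : ℝ) : 0 ≤ weightConst κ := by
  have := weightMass_nonneg κ
  have := unitBallVolume_pos
  unfold weightConst
  positivity

/-- The weight at `x` is at most `2^κ` times its mean over the ball of radius `r` about `x`.
Exchanging the integrals leaves the integral of `f` over balls against the total mass of the weight,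
and the factors `r³` of that mass and of the volume cancel. -/
lemma lintegral_mul_ballWeight_le {κ : ℝ} (hκ : 3 < κ) (c : Space) {r : ℝ} (hr : 0 < r)
    {f : Space → ENNReal} (hf : Measurable f) {A : ENNReal}
    (hA : ∀ z, ∫⁻ x in Metric.ball z r, f x ≤ A) :
    ∫⁻ x, f x * ENNReal.ofReal (ballWeight κ c r x) ≤ ENNReal.ofReal (weightConst κ) * A := by
  set w : Space → ENNReal := fun x => ENNReal.ofReal (ballWeight κ c r x) with hw
  have hwm : Measurable w :=
    ENNReal.measurable_ofReal.comp (continuous_ballWeight κ c hr).measurable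
  set v : ENNReal := ENNReal.ofReal (r ^ 3 * unitBallVolume) with hv
  have hv0 : v ≠ 0 := by
    have := unitBallVolume_pos
    rw [hv, Ne, ENNReal.ofReal_eq_zero, not_le]
    positivity
  have hD : MeasurableSet {z : Space × Space | dist z.2 z.1 < r} :=
    (isOpen_lt (by fun_prop) (by fun_prop)).measurableSet
  have hind : ∀ x z : Space, (Metric.ball x r).indicator (fun _ => (1 : ENNReal)) z =
      {z : Space × Space | dist z.2 z.1 < r}.indicator (fun _ => 1) (x, z) := fun x z => rfl
  have hswap : ∀ x z : Space, (Metric.ball x r).indicator (fun _ => (1 : ENNReal)) z =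
      (Metric.ball z r).indicator (fun _ => 1) x := fun x z => by
    simp only [Set.indicator, Metric.mem_ball, dist_comm]
  have hpt : ∀ x, v * (f x * w x) ≤ ENNReal.ofReal (2 ^ κ) *
      ∫⁻ z, f x * (w z * (Metric.ball x r).indicator (fun _ => 1) z) := by
    intro x
    have hwi : Measurable fun z => w z * (Metric.ball x r).indicator (fun _ => (1 : ENNReal)) z :=
      hwm.mul (measurable_const.indicator measurableSet_ball)
    rw [lintegral_const_mul _ hwi, mul_left_comm, mul_left_comm (ENNReal.ofReal (2 ^ κ))]
    gcongr f x * ?_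
    rw [← lintegral_const_mul _ hwi, hv, ← volume_ball_eq x hr.le, mul_comm,
      ← setLIntegral_const, ← lintegral_indicator measurableSet_ball]
    refine lintegral_mono fun z => ?_
    by_cases hz : z ∈ Metric.ball x r
    · rw [Set.indicator_of_mem hz, Set.indicator_of_mem hz, mul_one, hw, ← ENNReal.ofReal_mul
        (by positivity)]
      exact ENNReal.ofReal_le_ofReal (ballWeight_le_of_mem_ball (by linarith) c hr hz)
    · rw [Set.indicator_of_notMem hz]
      exact bot_le
  have hmeas : Measurable (Function.uncurry fun x z : Space =>
      f x * (w z * (Metric.ball x r).indicator (fun _ => (1 : ENNReal)) z)) := by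
    simp only [hind]
    exact (hf.comp measurable_fst).mul
      ((hwm.comp measurable_snd).mul (measurable_const.indicator hD))
  have hmain : v * ∫⁻ x, f x * w x ≤ ENNReal.ofReal (2 ^ κ) * (A * ∫⁻ z, w z) := by
    calc v * ∫⁻ x, f x * w x = ∫⁻ x, v * (f x * w x) :=
          (lintegral_const_mul _ (hf.mul hwm)).symm
      _ ≤ ∫⁻ x, ENNReal.ofReal (2 ^ κ) *
            ∫⁻ z, f x * (w z * (Metric.ball x r).indicator (fun _ => 1) z) := lintegral_mono hpt
      _ = ENNReal.ofReal (2 ^ κ) *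
            ∫⁻ x, ∫⁻ z, f x * (w z * (Metric.ball x r).indicator (fun _ => 1) z) :=
          lintegral_const_mul _ hmeas.lintegral_prod_right'
      _ = ENNReal.ofReal (2 ^ κ) *
            ∫⁻ z, ∫⁻ x, f x * (w z * (Metric.ball x r).indicator (fun _ => 1) z) := by
          rw [lintegral_lintegral_swap hmeas.aemeasurable]
      _ ≤ ENNReal.ofReal (2 ^ κ) * ∫⁻ z, A * w z := by
          gcongr with z
          calc ∫⁻ x, f x * (w z * (Metric.ball x r).indicator (fun _ => 1) z)
              = ∫⁻ x, w z * (Metric.ball z r).indicator f x := by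
                refine lintegral_congr fun x => ?_
                rw [hswap]
                by_cases hx : x ∈ Metric.ball z r
                · rw [Set.indicator_of_mem hx, Set.indicator_of_mem hx, mul_one, mul_comm]
                · rw [Set.indicator_of_notMem hx, Set.indicator_of_notMem hx]
                  simp
            _ = w z * ∫⁻ x in Metric.ball z r, f x := by
                rw [lintegral_const_mul _ (hf.indicator measurableSet_ball),
                  lintegral_indicator measurableSet_ball]
            _ ≤ A * w z := by
                rw [mul_comm]
                gcongr
                exact hA z
      _ = _ := by rw [lintegral_const_mul _ hwm]
  have hwint : ∫⁻ z, w z = ENNReal.ofReal (r ^ 3 * weightMass κ) := by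
    rw [← integral_ballWeight c hr, ofReal_integral_eq_lintegral_ofReal
      (integrable_ballWeight hκ c hr)]
    exact Filter.Eventually.of_forall fun x => (ballWeight_pos c hr x).le
  have hconst : ENNReal.ofReal (2 ^ κ) * (A * ENNReal.ofReal (r ^ 3 * weightMass κ)) =
      v * (ENNReal.ofReal (weightConst κ) * A) := by
    have hvp := unitBallVolume_pos
    have hm := weightMass_nonneg κ
    rw [mul_left_comm, ← ENNReal.ofReal_mul (by positivity), hv,
      ← mul_assoc (ENNReal.ofReal _) (ENNReal.ofReal _) A,
      ← ENNReal.ofReal_mul (by positivity), mul_comm]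
    congr 2
    unfold weightConst
    field_simp
  rw [hwint, hconst] at hmain
  exact (ENNReal.mul_le_mul_iff_right hv0 ENNReal.ofReal_ne_top).1 hmain

/-- A weighted integral is controlled by the integrals over all balls of the same radius. -/
lemma integral_mul_ballWeight_le {κ : ℝ} (hκ : 3 < κ) (c : Space) {r : ℝ} (hr : 0 < r)
    {f : Space → ℝ} (hf : Continuous f) (hf0 : ∀ x, 0 ≤ f x) {A : ℝ}
    (hA : ∀ z, ∫ x in Metric.ball z r, f x ≤ A) :
    ∫ x, f x * ballWeight κ c r x ≤ weightConst κ * A := by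
  have hA0 : 0 ≤ A := (setIntegral_nonneg measurableSet_ball fun x _ => hf0 x).trans (hA 0)
  have h := lintegral_mul_ballWeight_le hκ c hr (f := fun x => ENNReal.ofReal (f x))
    (ENNReal.measurable_ofReal.comp hf.measurable) (A := ENNReal.ofReal A) (fun z => by
      rw [← ofReal_integral_eq_lintegral_ofReal]
      · exact ENNReal.ofReal_le_ofReal (hA z)
      · exact (hf.continuousOn.integrableOn_compact
          (isCompact_closedBall z r)).mono_set Metric.ball_subset_closedBall
      · exact Filter.Eventually.of_forall hf0)
  rw [integral_eq_lintegral_of_nonneg_ae]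
  · refine ENNReal.toReal_le_of_le_ofReal (mul_nonneg (weightConst_nonneg κ) hA0) ?_
    rw [ENNReal.ofReal_mul (weightConst_nonneg κ)]
    refine le_trans (le_of_eq (lintegral_congr fun x => ?_)) h
    rw [ENNReal.ofReal_mul (hf0 x)]
  · exact Filter.Eventually.of_forall fun x => mul_nonneg (hf0 x) (ballWeight_pos c hr x).le
  · exact (hf.mul (continuous_ballWeight κ c hr)).aestronglyMeasurable

lemma integrable_mul_ballWeight {κ : ℝ} (hκ : 3 < κ) (c : Space) {r : ℝ} (hr : 0 < r)
    {f : Space → ℝ} (hf : Continuous f) {H : ℝ} (hH : ∀ x, ‖f x‖ ≤ H) :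
    Integrable fun x => f x * ballWeight κ c r x :=
  (integrable_ballWeight hκ c hr).bdd_mul hf.aestronglyMeasurable (Filter.Eventually.of_forall hH)

/-! ### Weighted moments of the bush. -/

/-- The bound for the square function of a bush of wave packets. -/
def bushBound (n : ℕ) (x : Space) : ℝ := 200000 * (1 + n ^ 4 / (n ^ 2 + ‖x‖ ^ 2))

lemma bushBound_nonneg (n : ℕ) (x : Space) : 0 ≤ bushBound n x := by
  unfold bushBound
  positivity

lemma bushBound_le {n : ℕ} (hn : 1 ≤ n) (x : Space) : bushBound n x ≤ 200000 * (1 + n ^ 2) := by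
  have hn' : (0 : ℝ) < n := by exact_mod_cast hn
  unfold bushBound
  gcongr
  rw [div_le_iff₀ (by positivity)]
  nlinarith [sq_nonneg (n : ℝ), sq_nonneg ‖x‖, mul_nonneg (sq_nonneg (n : ℝ)) (sq_nonneg ‖x‖)]

lemma continuous_bushBound {n : ℕ} (hn : 1 ≤ n) : Continuous (bushBound n) := by
  have hn' : (0 : ℝ) < n := by exact_mod_cast hn
  unfold bushBound
  refine continuous_const.mul (continuous_const.add (continuous_const.div (by fun_prop) fun x => ?_))
  positivity

/-- The central part `y` of the bound decays like `2n² (1 + |x|/n)^(-2)`. Where `y ≥ 1` its exponent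
may be raised from `q` to `σ/2`; a choice `σ > 3` then makes the resulting weight integrable over
all of space. -/
lemma bushBound_rpow_le {n : ℕ} (hn : 1 ≤ n) {q σ : ℝ} (hq : 0 ≤ q) (hqσ : q ≤ σ / 2) (x : Space) :
    bushBound n x ^ q ≤ 400000 ^ q * (2 + (2 * (n : ℝ) ^ 2) ^ (σ / 2) * ballWeight σ 0 n x) := by
  have hn' : (0 : ℝ) < n := by exact_mod_cast hn
  set y : ℝ := n ^ 4 / (n ^ 2 + ‖x‖ ^ 2) with hy
  have hy0 : 0 ≤ y := by positivity
  have hyle : y ≤ 2 * n ^ 2 * (1 + ‖x‖ / n) ^ (-2 : ℝ) := by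
    rw [Real.rpow_neg (by positivity), Real.rpow_two, ← div_eq_mul_inv, hy,
      div_le_div_iff₀ (by positivity) (by positivity)]
    have h1 : (1 + ‖x‖ / n) ^ 2 * n ^ 2 = (n + ‖x‖) ^ 2 := by field_simp
    have h2 : (n + ‖x‖) ^ 2 ≤ 2 * (n ^ 2 + ‖x‖ ^ 2) := by nlinarith [sq_nonneg (n - ‖x‖)]
    calc (n : ℝ) ^ 4 * (1 + ‖x‖ / n) ^ 2 = n ^ 2 * ((1 + ‖x‖ / n) ^ 2 * n ^ 2) := by ring
      _ ≤ n ^ 2 * (2 * (n ^ 2 + ‖x‖ ^ 2)) := by rw [h1]; gcongr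
      _ = _ := by ring
  have hyσ : y ^ (σ / 2) ≤ (2 * (n : ℝ) ^ 2) ^ (σ / 2) * ballWeight σ 0 n x := by
    calc y ^ (σ / 2) ≤ (2 * n ^ 2 * (1 + ‖x‖ / n) ^ (-2 : ℝ)) ^ (σ / 2) := by gcongr; linarith
      _ = _ := by
        rw [Real.mul_rpow (by positivity) (by positivity), ← Real.rpow_mul (by positivity),
          ballWeight, sub_zero]
        congr 2
        ring
  have hyq : (1 + y) ^ q ≤ 2 ^ q * (2 + y ^ (σ / 2)) := by
    rcases le_total y 1 with h | h
    · calc (1 + y) ^ q ≤ 2 ^ q := by gcongr; linarith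
        _ ≤ _ := le_mul_of_one_le_right (by positivity) (by
          have : 0 ≤ y ^ (σ / 2) := by positivity
          linarith)
    · calc (1 + y) ^ q ≤ (2 * y) ^ q := by gcongr; linarith
        _ = 2 ^ q * y ^ q := Real.mul_rpow (by norm_num) hy0
        _ ≤ 2 ^ q * y ^ (σ / 2) := by
          gcongr
        _ ≤ _ := by gcongr; linarith
  calc bushBound n x ^ q = 200000 ^ q * (1 + y) ^ q :=
        Real.mul_rpow (by norm_num) (by positivity)
    _ ≤ 200000 ^ q * (2 ^ q * (2 + y ^ (σ / 2))) := by gcongr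
    _ = 400000 ^ q * (2 + y ^ (σ / 2)) := by
        rw [← mul_assoc, ← Real.mul_rpow (by norm_num) (by norm_num)]
        norm_num
    _ ≤ _ := by gcongr

/-- The constant in the weighted moments of the square function of a bush. -/
def bushConst (q σ κ : ℝ) : ℝ := 400000 ^ q * (2 * weightMass κ + 2 ^ (σ / 2) * weightMass σ)

lemma bushConst_nonneg (q σ κ : ℝ) : 0 ≤ bushConst q σ κ := by
  have := weightMass_nonneg κ
  have := weightMass_nonneg σ
  unfold bushConst
  positivity

lemma integral_bushBound_rpow_le {n : ℕ} (hn : 1 ≤ n) {q σ κ : ℝ} (hκ : 3 < κ) (hσ : 3 < σ)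
    (hq : 0 ≤ q) (hqσ : q ≤ σ / 2) (c : Space) :
    ∫ x, bushBound n x ^ q * ballWeight κ c ((n : ℝ) ^ 2) x ≤
      bushConst q σ κ * ((n : ℝ) ^ 2) ^ ((σ + 3) / 2) := by
  have hn' : (0 : ℝ) < n := by exact_mod_cast hn
  have hn1 : (1 : ℝ) ≤ n := by exact_mod_cast hn
  have hR : (0 : ℝ) < (n : ℝ) ^ 2 := by positivity
  have hint1 := integrable_ballWeight hκ c hR
  have hint2 := integrable_ballWeight hσ 0 hn'
  calc ∫ x, bushBound n x ^ q * ballWeight κ c ((n : ℝ) ^ 2) x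
      ≤ ∫ x, 400000 ^ q * (2 * ballWeight κ c ((n : ℝ) ^ 2) x +
          (2 * (n : ℝ) ^ 2) ^ (σ / 2) * ballWeight σ 0 n x) := by
        refine integral_mono_of_nonneg (Filter.Eventually.of_forall fun x => ?_) ?_
          (Filter.Eventually.of_forall fun x => ?_)
        · exact mul_nonneg (Real.rpow_nonneg (bushBound_nonneg n x) _) (ballWeight_pos c hR x).le
        · exact ((hint1.const_mul _).add (hint2.const_mul _)).const_mul _
        · have h1 := bushBound_rpow_le hn hq hqσ x
          have h2 := ballWeight_le_one (κ := κ) (by linarith) c hR x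
          have h3 := ballWeight_pos (κ := κ) c hR x
          have h4 := ballWeight_pos (κ := σ) 0 hn' x
          calc _ ≤ 400000 ^ q * (2 + (2 * (n : ℝ) ^ 2) ^ (σ / 2) * ballWeight σ 0 n x) *
                ballWeight κ c ((n : ℝ) ^ 2) x := mul_le_mul_of_nonneg_right h1 h3.le
            _ = 400000 ^ q * (2 * ballWeight κ c ((n : ℝ) ^ 2) x +
                (2 * (n : ℝ) ^ 2) ^ (σ / 2) * ballWeight σ 0 n x *
                  ballWeight κ c ((n : ℝ) ^ 2) x) := by ring
            _ ≤ _ := mul_le_mul_of_nonneg_left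
                (add_le_add le_rfl (mul_le_of_le_one_right (by positivity) h2)) (by positivity)
    _ = 400000 ^ q * (2 * (((n : ℝ) ^ 2) ^ 3 * weightMass κ) +
          (2 * (n : ℝ) ^ 2) ^ (σ / 2) * ((n : ℝ) ^ 3 * weightMass σ)) := by
        rw [integral_const_mul, integral_add (hint1.const_mul _) (hint2.const_mul _),
          integral_const_mul, integral_const_mul, integral_ballWeight c hR,
          integral_ballWeight 0 hn']
    _ ≤ 400000 ^ q * (2 * (((n : ℝ) ^ 2) ^ ((σ + 3) / 2) * weightMass κ) +
          2 ^ (σ / 2) * (((n : ℝ) ^ 2) ^ ((σ + 3) / 2) * weightMass σ)) := by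
        -- The background contributes the volume `R³`, the centre `n^σ · n³ = R^((σ+3)/2)`; the
        -- latter dominates as `σ > 3`.
        have e1 : ((n : ℝ) ^ 2) ^ 3 ≤ ((n : ℝ) ^ 2) ^ ((σ + 3) / 2) := by
          rw [← Real.rpow_natCast ((n : ℝ) ^ 2) 3]
          exact Real.rpow_le_rpow_of_exponent_le (one_le_pow₀ hn1) (by push_cast; linarith)
        have e2 : (2 * (n : ℝ) ^ 2) ^ (σ / 2) * (n : ℝ) ^ 3 =
            2 ^ (σ / 2) * ((n : ℝ) ^ 2) ^ ((σ + 3) / 2) := by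
          rw [Real.mul_rpow (by norm_num) hR.le, mul_assoc]
          congr 1
          have : (n : ℝ) ^ 3 = ((n : ℝ) ^ 2) ^ (3 / 2 : ℝ) := by
            rw [← Real.rpow_natCast (n : ℝ) 2, ← Real.rpow_mul hn'.le, ← Real.rpow_natCast]
            norm_num
          rw [this, ← Real.rpow_add hR]
          congr 1
          ring
        have := weightMass_nonneg κ
        rw [← mul_assoc ((2 * (n : ℝ) ^ 2) ^ (σ / 2)), e2, mul_assoc (2 ^ (σ / 2))]
        gcongr
    _ = _ := by unfold bushConst; ring

/-! ### Random partitions by cyclic shifts of one choice per group. -/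

section Partition

variable {ι G : Type*} [AddCommGroup G] {M : ℕ} (φ : Fin M × G ≃ ι)

/-- Given a division of `ι` into `M` groups indexed by `G`, the set which takes from the group `g`
its element of index `j + s g`. -/
def choiceSet (s : Fin M → G) (j : G) : Finset ι :=
  Finset.univ.map ⟨fun g => φ (g, j + s g), fun _ _ h => congrArg Prod.fst (φ.injective h)⟩

lemma card_choiceSet (s : Fin M → G) (j : G) : (choiceSet φ s j).card = M := by
  simp [choiceSet]

lemma mem_choiceSet (s : Fin M → G) (j : G) (g : Fin M) (u : G) :
    φ (g, u) ∈ choiceSet φ s j ↔ u = j + s g := by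
  simp only [choiceSet, Finset.mem_map, Finset.mem_univ, true_and]
  constructor
  · rintro ⟨g', h⟩
    have h' := φ.injective h
    rw [Prod.mk.injEq] at h'
    rw [← h'.2, h'.1]
  · rintro rfl
    exact ⟨g, rfl⟩

lemma sum_choiceSet {A : Type*} [AddCommMonoid A] (s : Fin M → G) (j : G) (f : ι → A) :
    ∑ q ∈ choiceSet φ s j, f q = ∑ g, f (φ (g, j + s g)) := by
  simp only [choiceSet, Finset.sum_map]
  rfl

lemma choiceSet_injective (hM : 1 ≤ M) (s : Fin M → G) : Function.Injective (choiceSet φ s) := by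
  intro j j' h
  have h1 := (mem_choiceSet φ s j ⟨0, hM⟩ (j + s ⟨0, hM⟩)).2 rfl
  rw [h, mem_choiceSet] at h1
  exact add_right_cancel h1

variable [Fintype ι] [Fintype G]

/-- When `s g` is uniform so is `j + s g`; hence every part of the random partition has the same
law. -/
lemma sum_sum_shift {A : Type*} [AddCommMonoid A] (j : G) (f : ι → A) :
    ∑ g : Fin M, ∑ t : G, f (φ (g, j + t)) = ∑ q, f q := by
  rw [← φ.sum_comp, Fintype.sum_prod_type]
  refine Finset.sum_congr rfl fun g _ => ?_
  exact Equiv.sum_comp (Equiv.addLeft j) fun t => f (φ (g, t))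

variable [DecidableEq ι]

/-- The choice sets form a partition. -/
def choicePartition (hM : 1 ≤ M) (s : Fin M → G) : Finpartition (Finset.univ : Finset ι) :=
  Finpartition.ofExistsUnique (Finset.univ.image (choiceSet φ s)) (fun _ _ => Finset.subset_univ _)
    (fun q _ => by
      obtain ⟨⟨g, u⟩, rfl⟩ := φ.surjective q
      refine ⟨choiceSet φ s (u - s g), ⟨Finset.mem_image_of_mem _ (Finset.mem_univ _), ?_⟩, ?_⟩
      · rw [mem_choiceSet]
        abel
      · rintro A ⟨hA, hq⟩
        obtain ⟨j, -, rfl⟩ := Finset.mem_image.1 hA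
        rw [mem_choiceSet] at hq
        rw [hq, add_sub_cancel_right])
    (fun h => by
      obtain ⟨j, -, hj⟩ := Finset.mem_image.1 h
      have := card_choiceSet φ s j
      rw [hj, Finset.card_empty] at this
      omega)

lemma choicePartition_parts (hM : 1 ≤ M) (s : Fin M → G) :
    (choicePartition φ hM s).parts = Finset.univ.image (choiceSet φ s) := rfl

lemma sum_choicePartition (hM : 1 ≤ M) (s : Fin M → G) (f : Finset ι → ℝ) :
    ∑ A ∈ (choicePartition φ hM s).parts, f A = ∑ j, f (choiceSet φ s j) := by
  rw [choicePartition_parts, Finset.sum_image fun _ _ _ _ h => choiceSet_injective φ hM s h]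

end Partition

/-! ### Averaged decoupling for step functions. -/

section StepFunction

variable {n M k : ℕ} {p κ : ℝ} {b : Fin n × Fin n → ℂ}

lemma continuous_norm_ext_rpow {S : Set Plane} {F : Plane → ℂ} (hF : IntegrableOn F S)
    (hp : 0 ≤ p) : Continuous fun x => ‖ext S F x‖ ^ p :=
  (continuous_ext hF).norm.rpow_const fun _ => Or.inr hp

lemma norm_ext_rpow_le (S : Set Plane) (F : Plane → ℂ) (hp : 0 ≤ p) (x : Space) :
    ‖‖ext S F x‖ ^ p‖ ≤ (∫ ξ in S, ‖F ξ‖) ^ p := by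
  rw [Real.norm_of_nonneg (by positivity)]
  exact Real.rpow_le_rpow (norm_nonneg _) (norm_ext_le S F x) hp

lemma sum_norm_ext_choiceSet_rpow_le [NeZero k] (hn : 1 ≤ n) (hp : 2 ≤ p) (hp' : p ≤ 4)
    (hb : ∀ q, ‖b q‖ ≤ 1) (φ : Fin M × ZMod k ≃ Fin n × Fin n) (j : ZMod k) (x : Space) :
    ∑ s : Fin M → ZMod k, ‖ext (ensemble n (choiceSet φ s j)) (stepFun n b) x‖ ^ p ≤
      (k : ℝ) ^ M * (2 ^ p * ((k : ℝ) ^ (-p) * ‖ext unitSquare (stepFun n b) x‖ ^ p +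
        20 * ((k : ℝ) ^ (-(p / 2)) * bushBound n x ^ (p / 2) +
          (k : ℝ)⁻¹ * bushBound n x ^ (1 : ℝ)))) := by
  have hk : (0 : ℝ) < k := by exact_mod_cast Nat.pos_of_ne_zero (NeZero.ne k)
  have hint := (integrable_stepFun n b).integrableOn (s := unitSquare)
  set f : Fin n × Fin n → ℂ := fun q => ext (canonicalSquare n q) (stepFun n b) x with hf
  have hmain := sum_norm_random_choice_rpow_le (G := ZMod k) hp hp'
    (a := fun (g : Fin M) t => f (φ (g, j + t)))
    (fun g t => norm_ext_canonicalSquare_stepFun_le_one hb _ x) rfl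
  rw [sum_sum_shift φ j f, sum_sum_shift φ j fun q => ‖f q‖ ^ 2, ZMod.card,
    ← ext_unitSquare hn hint] at hmain
  simp_rw [ext_ensemble hint, sum_choiceSet]
  refine hmain.trans ?_
  have hV : ∑ q, ‖f q‖ ^ 2 ≤ bushBound n x := sum_norm_ext_stepFun_sq_le hb x
  have hB := bushBound_nonneg n x
  rw [Real.mul_rpow (by positivity) (norm_nonneg _), Real.inv_rpow hk.le, ← Real.rpow_neg hk.le,
    Real.rpow_one]
  gcongr
  calc ((k : ℝ)⁻¹ * ∑ q, ‖f q‖ ^ 2) ^ (p / 2) ≤ ((k : ℝ)⁻¹ * bushBound n x) ^ (p / 2) := by gcongr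
    _ = _ := by
      rw [Real.mul_rpow (by positivity) hB, Real.inv_rpow hk.le, ← Real.rpow_neg hk.le]

lemma norm_bushBound_rpow_le (hn : 1 ≤ n) {q : ℝ} (hq : 0 ≤ q) (x : Space) :
    ‖bushBound n x ^ q‖ ≤ (200000 * (1 + (n : ℝ) ^ 2)) ^ q := by
  rw [Real.norm_of_nonneg (Real.rpow_nonneg (bushBound_nonneg n x) q)]
  exact Real.rpow_le_rpow (bushBound_nonneg n x) (bushBound_le hn x) hq

/-- The decoupling inequality holds for each of the `k^M` choices `s`, with the same left-hand side.
Averaging over `s` replaces each part by its `p`-th moment. -/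
lemma integral_ball_ext_stepFun_le_weighted (hn : 1 ≤ n) (hM : 1 ≤ M) (hk : n ^ 2 = M * k)
    (hp : 2 ≤ p) (hp' : p ≤ 4) (hκ : 3 < κ) (hb : ∀ q, ‖b q‖ ≤ 1) {D : ℝ} (hD : 0 ≤ D)
    (hdec : DecouplesWith p κ n M D) (c : Space) :
    ∫ x in Metric.ball c ((n : ℝ) ^ 2), ‖ext unitSquare (stepFun n b) x‖ ^ p ≤
      D * 2 ^ p * ((k : ℝ) ^ (-(p / 2)) *
        ∫ x, ‖ext unitSquare (stepFun n b) x‖ ^ p * ballWeight κ c ((n : ℝ) ^ 2) x) +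
      20 * D * 2 ^ p * ((∫ x, bushBound n x ^ (p / 2) * ballWeight κ c ((n : ℝ) ^ 2) x) +
        (k : ℝ) ^ (p / 2 - 1) *
          ∫ x, bushBound n x ^ (1 : ℝ) * ballWeight κ c ((n : ℝ) ^ 2) x) := by
  have hk0 : k ≠ 0 := by
    rintro rfl
    have : 0 < n ^ 2 := by positivity
    omega
  have : NeZero k := ⟨hk0⟩
  have hkR : (0 : ℝ) < k := by exact_mod_cast Nat.pos_of_ne_zero hk0
  have hMR : (0 : ℝ) < M := by exact_mod_cast hM
  have hR : (0 : ℝ) < (n : ℝ) ^ 2 := by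
    have : (0 : ℝ) < n := by exact_mod_cast hn
    positivity
  have hRk : (n : ℝ) ^ 2 / M = k := by
    rw [div_eq_iff hMR.ne', mul_comm]
    exact_mod_cast hk
  have hint := (integrable_stepFun n b).integrableOn (s := unitSquare)
  have hp0 : 0 ≤ p := by linarith
  -- The geometry of the groups plays no role: any division into `M` groups of `k` squares will do.
  let φ : Fin M × ZMod k ≃ Fin n × Fin n := Fintype.equivOfCardEq (by
    simp only [Fintype.card_prod, Fintype.card_fin, ZMod.card]
    rw [← hk, sq])
  set w := ballWeight κ c ((n : ℝ) ^ 2) with hw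
  have hw0 : ∀ x, 0 ≤ w x := fun x => (ballWeight_pos c hR x).le
  set I := ∫ x in Metric.ball c ((n : ℝ) ^ 2), ‖ext unitSquare (stepFun n b) x‖ ^ p with hI
  set X := ∫ x, ‖ext unitSquare (stepFun n b) x‖ ^ p * w x with hX
  set Y := ∫ x, bushBound n x ^ (p / 2) * w x with hY
  set Z := ∫ x, bushBound n x ^ (1 : ℝ) * w x with hZ
  have hinte : ∀ S ⊆ unitSquare,
      Integrable fun x => ‖ext S (stepFun n b) x‖ ^ p * w x := fun S hS =>
    integrable_mul_ballWeight hκ c hR (continuous_norm_ext_rpow (hint.mono_set hS) hp0)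
      (norm_ext_rpow_le S _ hp0)
  have hintB : ∀ q : ℝ, 0 ≤ q → Integrable fun x => bushBound n x ^ q * w x := fun q hq =>
    integrable_mul_ballWeight hκ c hR
      ((continuous_bushBound hn).rpow_const fun _ => Or.inr hq) (norm_bushBound_rpow_le hn hq)
  have hens : ∀ A : Finset (Fin n × Fin n), ensemble n A ⊆ unitSquare := fun A =>
    Set.iUnion₂_subset fun q _ => canonicalSquare_subset_unitSquare n q
  have hs : ∀ s : Fin M → ZMod k, I ≤ D * (k : ℝ) ^ (p / 2 - 1) *
      ∑ j, ∫ x, ‖ext (ensemble n (choiceSet φ s j)) (stepFun n b) x‖ ^ p * w x := by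
    intro s
    have h := hdec (choicePartition φ hM s) (fun A hA => by
      rw [choicePartition_parts] at hA
      obtain ⟨j, -, rfl⟩ := Finset.mem_image.1 hA
      exact card_choiceSet φ s j) (stepFun n b) hint c
    rwa [hRk, sum_choicePartition φ hM s fun A => ∫ x, ‖ext (ensemble n A) (stepFun n b) x‖ ^ p *
      ballWeight κ c ((n : ℝ) ^ 2) x] at h
  have hj : ∀ j : ZMod k, ∑ s : Fin M → ZMod k,
      ∫ x, ‖ext (ensemble n (choiceSet φ s j)) (stepFun n b) x‖ ^ p * w x ≤
        (k : ℝ) ^ M * (2 ^ p * ((k : ℝ) ^ (-p) * X + 20 * ((k : ℝ) ^ (-(p / 2)) * Y +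
          (k : ℝ)⁻¹ * Z))) := by
    intro j
    rw [← integral_finsetSum _ fun s _ => hinte _ (hens _)]
    have hsum : (k : ℝ) ^ M * (2 ^ p * ((k : ℝ) ^ (-p) * X + 20 * ((k : ℝ) ^ (-(p / 2)) * Y +
          (k : ℝ)⁻¹ * Z))) = ∫ x, (k : ℝ) ^ M * (2 ^ p * ((k : ℝ) ^ (-p) *
          (‖ext unitSquare (stepFun n b) x‖ ^ p * w x) +
            20 * ((k : ℝ) ^ (-(p / 2)) * (bushBound n x ^ (p / 2) * w x) +
              (k : ℝ)⁻¹ * (bushBound n x ^ (1 : ℝ) * w x)))) := by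
      rw [integral_const_mul, integral_const_mul, integral_add, integral_const_mul,
        integral_const_mul, integral_add, integral_const_mul, integral_const_mul]
      · exact (hintB _ (by linarith)).const_mul _
      · exact (hintB _ (by norm_num)).const_mul _
      · exact (hinte _ subset_rfl).const_mul _
      · exact (((hintB _ (by linarith)).const_mul _).add
          ((hintB _ (by norm_num)).const_mul _)).const_mul _
    rw [hsum]
    refine integral_mono (integrable_finsetSum _ fun s _ => hinte _ (hens _)) ?_ fun x => ?_
    · exact ((((hinte _ subset_rfl).const_mul _).add ((((hintB _ (by linarith)).const_mul _).add
        ((hintB _ (by norm_num)).const_mul _)).const_mul _)).const_mul _).const_mul _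
    · have h := mul_le_mul_of_nonneg_right
        (sum_norm_ext_choiceSet_rpow_le hn hp hp' hb φ j x) (hw0 x)
      rw [Finset.sum_mul] at h
      refine h.trans (le_of_eq ?_)
      ring
  have hkM : (0 : ℝ) < (k : ℝ) ^ M := by positivity
  have hsum : (k : ℝ) ^ M * I ≤ D * (k : ℝ) ^ (p / 2 - 1) * (k * ((k : ℝ) ^ M *
      (2 ^ p * ((k : ℝ) ^ (-p) * X + 20 * ((k : ℝ) ^ (-(p / 2)) * Y + (k : ℝ)⁻¹ * Z))))) := by
    calc (k : ℝ) ^ M * I = ∑ s : Fin M → ZMod k, I := by simp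
      _ ≤ ∑ s : Fin M → ZMod k, D * (k : ℝ) ^ (p / 2 - 1) *
          ∑ j, ∫ x, ‖ext (ensemble n (choiceSet φ s j)) (stepFun n b) x‖ ^ p * w x :=
          Finset.sum_le_sum fun s _ => hs s
      _ = D * (k : ℝ) ^ (p / 2 - 1) * ∑ j, ∑ s : Fin M → ZMod k,
          ∫ x, ‖ext (ensemble n (choiceSet φ s j)) (stepFun n b) x‖ ^ p * w x := by
          rw [← Finset.mul_sum, Finset.sum_comm]
      _ ≤ D * (k : ℝ) ^ (p / 2 - 1) * ∑ j : ZMod k, ((k : ℝ) ^ M *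
          (2 ^ p * ((k : ℝ) ^ (-p) * X + 20 * ((k : ℝ) ^ (-(p / 2)) * Y + (k : ℝ)⁻¹ * Z)))) := by
          gcongr with j
          exact hj j
      _ = _ := by simp
  -- The power `k^(p/2-1)` is the decoupling loss and the factor `k` counts the parts.
  have e1 : (k : ℝ) ^ (p / 2 - 1) * k * (k : ℝ) ^ (-p) = (k : ℝ) ^ (-(p / 2)) := by
    rw [← Real.rpow_add_one hkR.ne', ← Real.rpow_add hkR]
    congr 1
    ring
  have e2 : (k : ℝ) ^ (p / 2 - 1) * k * (k : ℝ) ^ (-(p / 2)) = 1 := by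
    rw [← Real.rpow_add_one hkR.ne', ← Real.rpow_add hkR]
    simp
  have e3 : (k : ℝ) * (k : ℝ)⁻¹ = 1 := mul_inv_cancel₀ hkR.ne'
  refine le_of_mul_le_mul_left (hsum.trans (le_of_eq ?_)) hkM
  calc _ = (k : ℝ) ^ M * (D * 2 ^ p * (((k : ℝ) ^ (p / 2 - 1) * k * (k : ℝ) ^ (-p)) * X) +
        20 * D * 2 ^ p * (((k : ℝ) ^ (p / 2 - 1) * k * (k : ℝ) ^ (-(p / 2))) * Y +
          (k : ℝ) ^ (p / 2 - 1) * (((k : ℝ) * (k : ℝ)⁻¹) * Z))) := by ring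
    _ = _ := by rw [e1, e2, e3, one_mul, one_mul]

/-- The extension of a bush of wave packets over balls of radius `R`: the coherent part of the
decoupled sum is absorbed into the left-hand side. -/
theorem integral_ball_ext_stepFun_le (hn : 1 ≤ n) (hM : 1 ≤ M) (hk : n ^ 2 = M * k)
    (hp : 2 ≤ p) (hp' : p ≤ 4) (hκ : 3 < κ) (hb : ∀ q, ‖b q‖ ≤ 1) {D : ℝ} (hD : 0 ≤ D)
    (hdec : DecouplesWith p κ n M D) (hsmall : D * 2 ^ p * weightConst κ ≤ k / 2)
    {σ τ : ℝ} (hσ : 3 < σ) (hpσ : p ≤ σ) (hτ : 3 < τ) (c : Space) :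
    ∫ x in Metric.ball c ((n : ℝ) ^ 2), ‖ext unitSquare (stepFun n b) x‖ ^ p ≤
      40 * D * 2 ^ p * (bushConst (p / 2) σ κ * ((n : ℝ) ^ 2) ^ ((σ + 3) / 2) +
        (k : ℝ) ^ (p / 2 - 1) * (bushConst 1 τ κ * ((n : ℝ) ^ 2) ^ ((τ + 3) / 2))) := by
  have hk1 : (1 : ℝ) ≤ k := by
    have : k ≠ 0 := by
      rintro rfl
      have : 0 < n ^ 2 := by positivity
      omega
    exact_mod_cast Nat.one_le_iff_ne_zero.2 this
  have hR : (0 : ℝ) < (n : ℝ) ^ 2 := by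
    have : (0 : ℝ) < n := by exact_mod_cast hn
    positivity
  have hint := (integrable_stepFun n b).integrableOn (s := unitSquare)
  have hp0 : 0 ≤ p := by linarith
  set I : Space → ℝ := fun c =>
    ∫ x in Metric.ball c ((n : ℝ) ^ 2), ‖ext unitSquare (stepFun n b) x‖ ^ p with hI
  -- The trivial bound makes the supremum finite, without which nothing could be absorbed.
  have hbdd : BddAbove (Set.range I) := by
    refine ⟨(∫ ξ in unitSquare, ‖stepFun n b ξ‖) ^ p * (((n : ℝ) ^ 2) ^ 3 * unitBallVolume), ?_⟩
    rintro _ ⟨c, rfl⟩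
    have h := norm_setIntegral_le_of_norm_le_const (μ := volume)
      (s := Metric.ball c ((n : ℝ) ^ 2)) measure_ball_lt_top
      (f := fun x => ‖ext unitSquare (stepFun n b) x‖ ^ p)
      (fun x _ => norm_ext_rpow_le unitSquare (stepFun n b) hp0 x)
    rw [measureReal_def, volume_ball_eq c hR.le, ENNReal.toReal_ofReal (by
      have := unitBallVolume_pos
      positivity)] at h
    exact (le_abs_self _).trans h
  set T := 20 * D * 2 ^ p * (bushConst (p / 2) σ κ * ((n : ℝ) ^ 2) ^ ((σ + 3) / 2) +
        (k : ℝ) ^ (p / 2 - 1) * (bushConst 1 τ κ * ((n : ℝ) ^ 2) ^ ((τ + 3) / 2))) with hT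
  have hstep : ∀ c, I c ≤ (⨆ c, I c) / 2 + T := by
    intro c
    have h := integral_ball_ext_stepFun_le_weighted hn hM hk hp hp' hκ hb hD hdec c
    -- The weight has tails outside the ball, so the coherent term is compared with the supremum
    -- over all centres and not with `I c`.
    have hX := integral_mul_ballWeight_le hκ c hR
      (continuous_norm_ext_rpow hint hp0) (fun x => by positivity) (le_ciSup hbdd)
    have hY := integral_bushBound_rpow_le hn hκ hσ (q := p / 2) (by linarith) (by linarith) c
    have hZ := integral_bushBound_rpow_le hn hκ hτ (q := 1) (by norm_num) (by linarith) c
    have hsup : 0 ≤ ⨆ c, I c := Real.iSup_nonneg fun c =>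
      setIntegral_nonneg measurableSet_ball fun x _ => by positivity
    have hkp : (k : ℝ) ^ (-(p / 2)) ≤ (k : ℝ)⁻¹ := by
      rw [← Real.rpow_neg_one]
      exact Real.rpow_le_rpow_of_exponent_le hk1 (by linarith)
    have hwc := weightConst_nonneg κ
    refine h.trans (add_le_add ?_ ?_)
    · calc _ ≤ D * 2 ^ p * ((k : ℝ)⁻¹ * (weightConst κ * ⨆ c, I c)) := by
            gcongr
            exact integral_nonneg fun x => mul_nonneg (by positivity) (ballWeight_pos c hR x).le
        _ = D * 2 ^ p * weightConst κ * ((k : ℝ)⁻¹ * ⨆ c, I c) := by ring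
        _ ≤ k / 2 * ((k : ℝ)⁻¹ * ⨆ c, I c) := by gcongr
        _ = _ := by field_simp
    · rw [hT]
      gcongr
  have hA : (⨆ c, I c) ≤ (⨆ c, I c) / 2 + T := ciSup_le hstep
  have hc : I c ≤ ⨆ c, I c := le_ciSup hbdd c
  have hT2 : I c ≤ 2 * T := by linarith
  refine hT2.trans (le_of_eq ?_)
  rw [hT]
  ring

end StepFunction

/-! ### Comparison of the extension operator with exponential sums over the corners. -/

/-- The point of the paraboloid above the lower left corner of a canonical square. -/
def cornerPoint (n : ℕ) (q : Fin n × Fin n) : Space :=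
  !₂[(q.1 : ℝ) / n, (q.2 : ℝ) / n, ((q.1 : ℝ) / n) ^ 2 + ((q.2 : ℝ) / n) ^ 2]

lemma abs_sq_sub_sq_le {n : ℕ} {j : Fin n} {t : ℝ}
    (ht : t ∈ Set.Icc ((j : ℝ) / n) (((j : ℝ) + 1) / n)) :
    |t - j / n| ≤ 1 / n ∧ |t ^ 2 - ((j : ℝ) / n) ^ 2| ≤ 2 / n := by
  have hn : (0 : ℝ) < n := by exact_mod_cast j.pos
  have h0 : 0 ≤ (j : ℝ) / n := by positivity
  have h1 : ((j : ℝ) + 1) / n ≤ 1 := by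
    rw [div_le_one hn]
    exact_mod_cast j.isLt
  have h2 := ht.1
  have h3 := ht.2
  have h4 : |t - j / n| ≤ 1 / n := by
    rw [abs_of_nonneg (by linarith)]
    rw [add_div] at h3
    linarith
  refine ⟨h4, ?_⟩
  have h5 : t ^ 2 - ((j : ℝ) / n) ^ 2 = (t - j / n) * (t + j / n) := by ring
  have h6 : |t + j / n| ≤ 2 := by
    rw [abs_of_nonneg (by linarith)]
    linarith
  rw [h5, abs_mul]
  calc |t - j / n| * |t + j / n| ≤ 1 / n * 2 := by gcongr
    _ = 2 / n := by ring

lemma abs_lift_sub_cornerPoint_le {n : ℕ} {q : Fin n × Fin n} {ξ : Plane}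
    (hξ : ξ ∈ canonicalSquare n q) (i : Fin 3) : |(lift ξ - cornerPoint n q) i| ≤ 4 / n := by
  obtain ⟨h1, h2⟩ := abs_sq_sub_sq_le hξ.1
  obtain ⟨h3, h4⟩ := abs_sq_sub_sq_le hξ.2
  have hn : (0 : ℝ) < n := by exact_mod_cast q.1.pos
  have h12 : (1 : ℝ) / n ≤ 4 / n := by gcongr; norm_num
  fin_cases i
  · exact h1.trans h12
  · exact h3.trans h12
  · have : (lift ξ - cornerPoint n q) 2 = (ξ 0 ^ 2 - ((q.1 : ℝ) / n) ^ 2) +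
        (ξ 1 ^ 2 - ((q.2 : ℝ) / n) ^ 2) := by
      rw [PiLp.sub_apply, lift_two]
      simp only [cornerPoint]
      simp
      ring
    simp only [Fin.reduceFinMk]
    rw [this]
    refine (abs_add_le _ _).trans ((add_le_add h2 h4).trans (le_of_eq ?_))
    ring

lemma abs_apply_le_norm (x : Space) (i : Fin 3) : |x i| ≤ ‖x‖ := by
  simpa using PiLp.norm_apply_le x i

lemma abs_inner_lift_sub_cornerPoint_le_mul_norm {n : ℕ} {q : Fin n × Fin n} {ξ : Plane} (x : Space)
    (hξ : ξ ∈ canonicalSquare n q) : |inner ℝ (lift ξ - cornerPoint n q) x| ≤ 12 / n * ‖x‖ := by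
  have hn : (0 : ℝ) < n := by exact_mod_cast q.1.pos
  have h : ∀ i, |(lift ξ - cornerPoint n q) i * x i| ≤ 4 / n * ‖x‖ := fun i => by
    rw [abs_mul]
    gcongr
    · exact abs_lift_sub_cornerPoint_le hξ i
    · exact abs_apply_le_norm x i
  rw [inner_space]
  refine (abs_add_three _ _ _).trans ?_
  have e1 : 12 / n * ‖x‖ = 4 / n * ‖x‖ + 4 / n * ‖x‖ + 4 / n * ‖x‖ := by ring
  rw [e1]
  linarith [h 0, h 1, h 2]

lemma abs_inner_lift_sub_cornerPoint_le {n : ℕ} {q : Fin n × Fin n} {ξ : Plane} {x : Space}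
    (hξ : ξ ∈ canonicalSquare n q) (hx : ‖x‖ ≤ n / 1000) :
    |inner ℝ (lift ξ - cornerPoint n q) x| ≤ 12 / 1000 := by
  have hn : (0 : ℝ) < n := by exact_mod_cast q.1.pos
  calc _ ≤ 12 / n * ‖x‖ := abs_inner_lift_sub_cornerPoint_le_mul_norm x hξ
    _ ≤ 12 / n * (n / 1000) := by gcongr
    _ = 12 / 1000 := by field_simp

/-- The exponential sum over the corners of the canonical squares. -/
def cornerSum (n : ℕ) (b : Fin n × Fin n → ℂ) (x : Space) : ℂ :=
  ∑ q, e (inner ℝ (cornerPoint n q) x) * b q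

lemma continuous_cornerSum (n : ℕ) (b : Fin n × Fin n → ℂ) : Continuous (cornerSum n b) := by
  unfold cornerSum
  fun_prop

lemma norm_cornerSum_le {n : ℕ} {b : Fin n × Fin n → ℂ} (hb : ∀ q, ‖b q‖ ≤ 1) (x : Space) :
    ‖cornerSum n b x‖ ≤ (n : ℝ) ^ 2 := by
  unfold cornerSum
  calc _ ≤ ∑ q : Fin n × Fin n, (1 : ℝ) := by
        refine norm_sum_le_of_le _ fun q _ => ?_
        rw [norm_mul, norm_e, one_mul]
        exact hb q
    _ = _ := by simp [sq]

/-- The terms of the expansion of the extension operator in powers of the distance to the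
corners. -/
def cornerMoment (n : ℕ) (F : Fin n × Fin n → Plane → ℂ) (m : ℕ) (x : Space) : ℂ :=
  ∑ q, e (inner ℝ (cornerPoint n q) x) * ∫ ξ in canonicalSquare n q,
    F q ξ * ((inner ℝ (lift ξ - cornerPoint n q) x : ℝ) : ℂ) ^ m

/-- The supremum of the `L^p` norms of the exponential sums with coefficients bounded by `1`. -/
def cornerNorm (n : ℕ) (p : ℝ) (μ : Measure Space) : ENNReal :=
  ⨆ b : {b : Fin n × Fin n → ℂ // ∀ q, ‖b q‖ ≤ 1}, eLpNorm (cornerSum n b) (ENNReal.ofReal p) μ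

lemma cornerMoment_zero (n : ℕ) (F : Fin n × Fin n → Plane → ℂ) :
    cornerMoment n F 0 = cornerSum n fun q => ∫ ξ in canonicalSquare n q, F q ξ := by
  ext x
  simp [cornerMoment, cornerSum]

section

variable {n : ℕ} {F : Fin n × Fin n → Plane → ℂ}

/-- Multiplication of the amplitudes by a normalized coordinate of the distance to the corner. -/
def cornerShift (n : ℕ) (i : Fin 3) (F : Fin n × Fin n → Plane → ℂ) (q : Fin n × Fin n)
    (ξ : Plane) : ℂ :=
  F q ξ * ((n / 4 * (lift ξ - cornerPoint n q) i : ℝ) : ℂ)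

lemma norm_cornerShift_le (i : Fin 3) {q : Fin n × Fin n} {ξ : Plane}
    (hξ : ξ ∈ canonicalSquare n q) : ‖cornerShift n i F q ξ‖ ≤ ‖F q ξ‖ := by
  have hn : (0 : ℝ) < n := by exact_mod_cast q.1.pos
  unfold cornerShift
  rw [norm_mul, Complex.norm_real, Real.norm_eq_abs, abs_mul, abs_of_pos (by positivity)]
  refine mul_le_of_le_one_right (norm_nonneg _) ?_
  calc _ ≤ (n : ℝ) / 4 * (4 / n) := by gcongr; exact abs_lift_sub_cornerPoint_le hξ i
    _ = 1 := by field_simp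

lemma integrableOn_mul_continuous {q : Fin n × Fin n} {f : Plane → ℂ}
    (hf : IntegrableOn f (canonicalSquare n q)) {g : Plane → ℂ} (hg : Continuous g) {H : ℝ}
    (hH : ∀ ξ ∈ canonicalSquare n q, ‖g ξ‖ ≤ H) :
    IntegrableOn (fun ξ => f ξ * g ξ) (canonicalSquare n q) := by
  refine Integrable.mul_bdd (c := H) hf hg.aestronglyMeasurable ?_
  filter_upwards [ae_restrict_mem (measurableSet_canonicalSquare n q)] with ξ hξ
  exact hH ξ hξ

lemma integrableOn_cornerShift (hF : ∀ q, IntegrableOn (F q) (canonicalSquare n q)) (i : Fin 3)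
    (q : Fin n × Fin n) : IntegrableOn (cornerShift n i F q) (canonicalSquare n q) := by
  have hn : (0 : ℝ) < n := by exact_mod_cast q.1.pos
  refine integrableOn_mul_continuous (hF q) (by fun_prop) (H := (n : ℝ) / 4 * (4 / n)) fun ξ hξ => ?_
  rw [Complex.norm_real, Real.norm_eq_abs, abs_mul, abs_of_pos (by positivity)]
  gcongr
  exact abs_lift_sub_cornerPoint_le hξ i

lemma integral_norm_cornerShift_le (hF : ∀ q, IntegrableOn (F q) (canonicalSquare n q))
    (hF1 : ∀ q, ∫ ξ in canonicalSquare n q, ‖F q ξ‖ ≤ 1) (i : Fin 3) (q : Fin n × Fin n) :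
    ∫ ξ in canonicalSquare n q, ‖cornerShift n i F q ξ‖ ≤ 1 := by
  refine le_trans (setIntegral_mono_on ((integrableOn_cornerShift hF i q).norm) (hF q).norm
    (measurableSet_canonicalSquare n q) fun ξ hξ => norm_cornerShift_le i hξ) (hF1 q)

lemma integrableOn_cornerMoment (hF : ∀ q, IntegrableOn (F q) (canonicalSquare n q)) (m : ℕ)
    (x : Space) (q : Fin n × Fin n) :
    IntegrableOn (fun ξ => F q ξ * ((inner ℝ (lift ξ - cornerPoint n q) x : ℝ) : ℂ) ^ m)
      (canonicalSquare n q) := by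
  refine integrableOn_mul_continuous (hF q) (by fun_prop) (H := (12 / n * ‖x‖) ^ m) fun ξ hξ => ?_
  rw [norm_pow, Complex.norm_real, Real.norm_eq_abs]
  gcongr
  exact abs_inner_lift_sub_cornerPoint_le_mul_norm x hξ

/-- One factor of the inner product is split into coordinates. The frequency part, normalized by
`n/4`, goes into the amplitudes, which do not grow; the factor `4 x i / n` stays outside. -/
lemma cornerMoment_succ (hn : 1 ≤ n) (hF : ∀ q, IntegrableOn (F q) (canonicalSquare n q)) (m : ℕ) :
    cornerMoment n F (m + 1) = ∑ i : Fin 3,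
      fun x => ((4 / n * x i : ℝ) : ℂ) * cornerMoment n (cornerShift n i F) m x := by
  have hn' : (n : ℂ) ≠ 0 := by exact_mod_cast (by omega : n ≠ 0)
  ext x
  simp only [cornerMoment, Finset.sum_apply, Finset.mul_sum]
  rw [Finset.sum_comm]
  refine Finset.sum_congr rfl fun q _ => ?_
  simp_rw [mul_left_comm _ (e _), ← Finset.mul_sum, ← integral_const_mul]
  rw [← integral_finsetSum _ fun i _ =>
    (integrableOn_cornerMoment (integrableOn_cornerShift hF i) m x q).const_mul _]
  rw [integral_const_mul]
  congr 1
  refine integral_congr_ae (Filter.Eventually.of_forall fun ξ => ?_)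
  have ht : ((inner ℝ (lift ξ - cornerPoint n q) x : ℝ) : ℂ) =
      ∑ i : Fin 3, (((lift ξ - cornerPoint n q) i : ℝ) : ℂ) * ((x i : ℝ) : ℂ) := by
    rw [inner_space, Fin.sum_univ_three]
    push_cast
    rfl
  simp only [cornerShift]
  rw [pow_succ]
  nth_rewrite 2 [ht]
  rw [Finset.mul_sum, Finset.mul_sum]
  refine Finset.sum_congr rfl fun i _ => ?_
  push_cast
  field_simp

/-- Each reduction of `m` by one costs three coordinates times `4/1000` and ends with admissible
amplitudes, so the induction must let `F` vary. At `m = 0` the sum is one of those in `cornerNorm`.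
-/
lemma continuous_cornerMoment_and_eLpNorm_le (hn : 1 ≤ n) {p : ℝ} (hp : 1 ≤ p) {μ : Measure Space}
    (hμ : ∀ᵐ x ∂μ, ‖x‖ ≤ n / 1000) (m : ℕ)
    (hF : ∀ q, IntegrableOn (F q) (canonicalSquare n q))
    (hF1 : ∀ q, ∫ ξ in canonicalSquare n q, ‖F q ξ‖ ≤ 1) :
    Continuous (cornerMoment n F m) ∧ eLpNorm (cornerMoment n F m) (ENNReal.ofReal p) μ ≤
      ENNReal.ofReal ((12 / 1000) ^ m) * cornerNorm n p μ := by
  have hn' : (0 : ℝ) < n := by exact_mod_cast hn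
  induction m generalizing F with
  | zero =>
    rw [cornerMoment_zero, pow_zero, ENNReal.ofReal_one, one_mul]
    refine ⟨continuous_cornerSum n _, ?_⟩
    exact le_iSup (fun b : {b : Fin n × Fin n → ℂ // ∀ q, ‖b q‖ ≤ 1} =>
      eLpNorm (cornerSum n b) (ENNReal.ofReal p) μ)
      ⟨_, fun q => (norm_integral_le_integral_norm _).trans (hF1 q)⟩
  | succ m ih =>
    have hi := fun i : Fin 3 =>
      ih (integrableOn_cornerShift hF i) (integral_norm_cornerShift_le hF hF1 i)
    have hcont : ∀ i : Fin 3, Continuous fun x : Space =>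
        ((4 / n * x i : ℝ) : ℂ) * cornerMoment n (cornerShift n i F) m x := fun i =>
      Continuous.mul (by fun_prop) (hi i).1
    rw [cornerMoment_succ hn hF]
    refine ⟨by
      rw [show (∑ i : Fin 3, fun x : Space =>
        ((4 / n * x i : ℝ) : ℂ) * cornerMoment n (cornerShift n i F) m x) = fun x => ∑ i : Fin 3,
        ((4 / n * x i : ℝ) : ℂ) * cornerMoment n (cornerShift n i F) m x by ext; simp]
      exact continuous_finsetSum _ fun i _ => hcont i, ?_⟩
    refine (eLpNorm_sum_le (fun i _ => (hcont i).aestronglyMeasurable)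
      (by simpa using hp)).trans ?_
    calc _ ≤ ∑ i : Fin 3, ENNReal.ofReal (4 / 1000) *
          (ENNReal.ofReal ((12 / 1000) ^ m) * cornerNorm n p μ) := by
          refine Finset.sum_le_sum fun i _ => ?_
          refine le_trans (eLpNorm_le_mul_eLpNorm_of_ae_le_mul ?_ _) (mul_le_mul_right (hi i).2 _)
          filter_upwards [hμ] with x hx
          rw [norm_mul, Complex.norm_real, Real.norm_eq_abs, abs_mul, abs_of_pos (by positivity)]
          gcongr
          calc 4 / n * |x i| ≤ 4 / n * (n / 1000) := by
                gcongr
                exact (abs_apply_le_norm x i).trans hx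
            _ = _ := by field_simp
      _ = _ := by
          rw [Finset.sum_const, Finset.card_univ, Fintype.card_fin, nsmul_eq_mul, ← mul_assoc,
            ← mul_assoc, Nat.cast_ofNat, ← ENNReal.ofReal_ofNat, ← ENNReal.ofReal_mul (by norm_num),
            ← ENNReal.ofReal_mul (by norm_num)]
          congr 2
          ring

end

/-- The radius `n/1000` is chosen to make `2π|t| ≤ 1/10`. -/
lemma norm_e_sub_sum_le {t : ℝ} (ht : |t| ≤ 12 / 1000) (K : ℕ) :
    ‖e t - ∑ m ∈ Finset.range K, (2 * Real.pi * Complex.I) ^ m / (m.factorial : ℂ) * (t : ℂ) ^ m‖ ≤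
      3 * (1 / 10) ^ K := by
  have h := Complex.norm_exp_sub_sum_le_norm_mul_exp (2 * Real.pi * t * Complex.I) K
  have hn : ‖(2 * Real.pi * t * Complex.I : ℂ)‖ ≤ 1 / 10 := by
    simp only [norm_mul, Complex.norm_I, mul_one, Complex.norm_real, Real.norm_eq_abs,
      abs_of_pos Real.pi_pos, RCLike.norm_ofNat]
    have := Real.pi_lt_four
    nlinarith [abs_nonneg t, Real.pi_pos]
  have he : Real.exp ‖(2 * Real.pi * t * Complex.I : ℂ)‖ ≤ 3 :=
    (Real.exp_le_exp.2 (hn.trans (by norm_num))).trans Real.exp_one_lt_three.le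
  have hsum : ∑ m ∈ Finset.range K, (2 * Real.pi * Complex.I) ^ m / (m.factorial : ℂ) * (t : ℂ) ^ m =
      ∑ m ∈ Finset.range K, (2 * Real.pi * t * Complex.I) ^ m / (m.factorial : ℂ) := by
    refine Finset.sum_congr rfl fun m _ => ?_
    rw [show (2 * Real.pi * t * Complex.I : ℂ) = 2 * Real.pi * Complex.I * t by ring, mul_pow]
    ring
  rw [hsum]
  refine h.trans ?_
  rw [mul_comm]
  gcongr

variable {n : ℕ} {p : ℝ} {μ : Measure Space}

/-- The coefficients of the expansion in powers of the distance to the corners. -/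
def expCoeff (m : ℕ) : ℂ := (2 * Real.pi * Complex.I) ^ m / (m.factorial : ℂ)

lemma norm_expCoeff_mul_le (m : ℕ) : ‖expCoeff m‖ * (12 / 1000) ^ m ≤ (1 / 10) ^ m := by
  have h : ‖expCoeff m‖ ≤ 8 ^ m := by
    unfold expCoeff
    rw [norm_div, Complex.norm_natCast, norm_pow]
    have hm : (1 : ℝ) ≤ m.factorial := by exact_mod_cast m.factorial_pos
    refine (div_le_self (by positivity) hm).trans ?_
    gcongr
    simp only [norm_mul, Complex.norm_I, mul_one, Complex.norm_real, Real.norm_eq_abs,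
      abs_of_pos Real.pi_pos, RCLike.norm_ofNat]
    linarith [Real.pi_lt_four]
  calc _ ≤ (8 : ℝ) ^ m * (12 / 1000) ^ m := by gcongr
    _ = (96 / 1000) ^ m := by rw [← mul_pow]; norm_num
    _ ≤ _ := pow_le_pow_left₀ (by norm_num) (by norm_num) m

lemma ext_eq_sum_corner (hn : 1 ≤ n) {F : Plane → ℂ} (hF : IntegrableOn F unitSquare) (x : Space) :
    ext unitSquare F x = ∑ q, e (inner ℝ (cornerPoint n q) x) * ∫ ξ in canonicalSquare n q,
      F ξ * e (inner ℝ (lift ξ - cornerPoint n q) x) := by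
  rw [ext_unitSquare hn hF]
  refine Finset.sum_congr rfl fun q _ => ?_
  unfold ext
  rw [← integral_const_mul]
  congr 1
  ext ξ
  rw [mul_left_comm, ← e_add, ← inner_add_left, add_sub_cancel]

/-- The remainders of all squares are added with no cancellation; the loss `n²` is harmless because
`K` will tend to infinity with `n` fixed. -/
lemma norm_ext_sub_sum_cornerMoment_le (hn : 1 ≤ n) {F : Plane → ℂ}
    (hF : IntegrableOn F unitSquare) (hF1 : ∀ q, ∫ ξ in canonicalSquare n q, ‖F ξ‖ ≤ 1)
    {x : Space} (hx : ‖x‖ ≤ n / 1000) (K : ℕ) :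
    ‖ext unitSquare F x - ∑ m ∈ Finset.range K, expCoeff m * cornerMoment n (fun _ => F) m x‖ ≤
      (n : ℝ) ^ 2 * (3 * (1 / 10) ^ K) := by
  have hFq : ∀ q, IntegrableOn F (canonicalSquare n q) := fun q =>
    hF.mono_set (canonicalSquare_subset_unitSquare n q)
  have hq : ∀ q, ‖(∫ ξ in canonicalSquare n q, F ξ * e (inner ℝ (lift ξ - cornerPoint n q) x)) -
      ∑ m ∈ Finset.range K, expCoeff m * ∫ ξ in canonicalSquare n q,
        F ξ * ((inner ℝ (lift ξ - cornerPoint n q) x : ℝ) : ℂ) ^ m‖ ≤ 3 * (1 / 10) ^ K := by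
    intro q
    have hm : ∀ m, IntegrableOn (fun ξ => expCoeff m *
        (F ξ * ((inner ℝ (lift ξ - cornerPoint n q) x : ℝ) : ℂ) ^ m)) (canonicalSquare n q) :=
      fun m => (integrableOn_cornerMoment hFq m x q).const_mul _
    have he : IntegrableOn (fun ξ => F ξ * e (inner ℝ (lift ξ - cornerPoint n q) x))
        (canonicalSquare n q) :=
      integrableOn_mul_continuous (hFq q) (by fun_prop) (H := 1) fun ξ _ => (norm_e _).le
    simp_rw [← integral_const_mul]
    rw [← integral_finsetSum _ fun m _ => hm m,
      ← integral_sub he (integrable_finsetSum _ fun m _ => hm m)]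
    refine (norm_integral_le_integral_norm _).trans ?_
    calc _ ≤ ∫ ξ in canonicalSquare n q, 3 * (1 / 10) ^ K * ‖F ξ‖ := by
          refine setIntegral_mono_on
            (he.sub (integrable_finsetSum _ fun m _ => hm m)).norm ((hFq q).norm.const_mul _)
            (measurableSet_canonicalSquare n q) fun ξ hξ => ?_
          have h := norm_e_sub_sum_le (abs_inner_lift_sub_cornerPoint_le hξ hx) K
          have h2 : F ξ * e (inner ℝ (lift ξ - cornerPoint n q) x) -
              ∑ m ∈ Finset.range K, expCoeff m *
                (F ξ * ((inner ℝ (lift ξ - cornerPoint n q) x : ℝ) : ℂ) ^ m) =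
              (e (inner ℝ (lift ξ - cornerPoint n q) x) - ∑ m ∈ Finset.range K,
                (2 * Real.pi * Complex.I) ^ m / (m.factorial : ℂ) *
                  ((inner ℝ (lift ξ - cornerPoint n q) x : ℝ) : ℂ) ^ m) * F ξ := by
            rw [sub_mul, Finset.sum_mul, mul_comm]
            congr 1
            refine Finset.sum_congr rfl fun m _ => ?_
            unfold expCoeff
            ring
          rw [h2, norm_mul]
          gcongr
      _ = 3 * (1 / 10) ^ K * ∫ ξ in canonicalSquare n q, ‖F ξ‖ := integral_const_mul _ _
      _ ≤ _ := mul_le_of_le_one_right (by positivity) (hF1 q)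
  have hsum : ext unitSquare F x - ∑ m ∈ Finset.range K,
      expCoeff m * cornerMoment n (fun _ => F) m x = ∑ q, e (inner ℝ (cornerPoint n q) x) *
        ((∫ ξ in canonicalSquare n q, F ξ * e (inner ℝ (lift ξ - cornerPoint n q) x)) -
          ∑ m ∈ Finset.range K, expCoeff m * ∫ ξ in canonicalSquare n q,
            F ξ * ((inner ℝ (lift ξ - cornerPoint n q) x : ℝ) : ℂ) ^ m) := by
    rw [ext_eq_sum_corner hn hF]
    simp only [mul_sub, Finset.sum_sub_distrib, cornerMoment, Finset.mul_sum]
    congr 1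
    rw [Finset.sum_comm]
    exact Finset.sum_congr rfl fun q _ => Finset.sum_congr rfl fun m _ => by ring
  rw [hsum]
  calc _ ≤ ∑ q : Fin n × Fin n, (3 * (1 / 10) ^ K : ℝ) := by
        refine norm_sum_le_of_le _ fun q _ => ?_
        rw [norm_mul, norm_e, one_mul]
        exact hq q
    _ = _ := by simp [sq]

lemma sum_range_tenth_pow_le (K : ℕ) : ∑ m ∈ Finset.range K, (1 / 10 : ℝ) ^ (m + 1) ≤ 1 / 4 := by
  have h : ∑ m ∈ Finset.range K, (1 / 10 : ℝ) ^ (m + 1) = (1 - (1 / 10) ^ K) / 9 := by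
    induction K with
    | zero => simp
    | succ K ih => rw [Finset.sum_range_succ, ih]; ring
  have : (0 : ℝ) ≤ (1 / 10) ^ K := by positivity
  rw [h]
  linarith

lemma eLpNorm_sum_cornerMoment_le (hn : 1 ≤ n) (hp : 1 ≤ p)
    (hμ : ∀ᵐ x ∂μ, ‖x‖ ≤ n / 1000) {F : Plane → ℂ} (hF : IntegrableOn F unitSquare)
    (hF1 : ∀ q, ∫ ξ in canonicalSquare n q, ‖F ξ‖ ≤ 1) (K : ℕ) :
    eLpNorm (∑ m ∈ Finset.range K, fun x => expCoeff (m + 1) *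
      cornerMoment n (fun _ => F) (m + 1) x) (ENNReal.ofReal p) μ ≤
        ENNReal.ofReal (1 / 4) * cornerNorm n p μ := by
  have hFq : ∀ q, IntegrableOn F (canonicalSquare n q) := fun q =>
    hF.mono_set (canonicalSquare_subset_unitSquare n q)
  have hm := fun m : ℕ => continuous_cornerMoment_and_eLpNorm_le hn hp hμ (m + 1)
    (F := fun _ => F) hFq hF1
  refine (eLpNorm_sum_le (fun m _ => (continuous_const.mul (hm m).1).aestronglyMeasurable)
    (by simpa using hp)).trans ?_
  calc _ ≤ ∑ m ∈ Finset.range K, ENNReal.ofReal ((1 / 10) ^ (m + 1)) * cornerNorm n p μ := by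
        refine Finset.sum_le_sum fun m _ => ?_
        have h1 : eLpNorm (fun x => expCoeff (m + 1) * cornerMoment n (fun _ => F) (m + 1) x)
            (ENNReal.ofReal p) μ ≤ ENNReal.ofReal ‖expCoeff (m + 1)‖ *
              eLpNorm (cornerMoment n (fun _ => F) (m + 1)) (ENNReal.ofReal p) μ :=
          eLpNorm_le_mul_eLpNorm_of_ae_le_mul
            (Filter.Eventually.of_forall fun x => (norm_mul _ _).le) _
        refine h1.trans ((mul_le_mul_right (hm m).2 _).trans ?_)
        rw [← mul_assoc, ← ENNReal.ofReal_mul (norm_nonneg _)]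
        gcongr
        exact norm_expCoeff_mul_le (m + 1)
    _ = ENNReal.ofReal (∑ m ∈ Finset.range K, (1 / 10) ^ (m + 1)) * cornerNorm n p μ := by
        rw [← Finset.sum_mul, ENNReal.ofReal_sum_of_nonneg fun m _ => by positivity]
    _ ≤ _ := by
        gcongr
        exact sum_range_tenth_pow_le K

/-- On a ball of radius `n/1000` the extension operator is close to an exponential sum. -/
lemma eLpNorm_ext_sub_cornerSum_le (hn : 1 ≤ n) (hp : 1 ≤ p) [IsFiniteMeasure μ]
    (hμ : ∀ᵐ x ∂μ, ‖x‖ ≤ n / 1000) {F : Plane → ℂ} (hF : IntegrableOn F unitSquare)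
    (hF1 : ∀ q, ∫ ξ in canonicalSquare n q, ‖F ξ‖ ≤ 1) :
    eLpNorm (ext unitSquare F - cornerSum n fun q => ∫ ξ in canonicalSquare n q, F ξ)
      (ENNReal.ofReal p) μ ≤ ENNReal.ofReal (1 / 4) * cornerNorm n p μ := by
  have hFq : ∀ q, IntegrableOn F (canonicalSquare n q) := fun q =>
    hF.mono_set (canonicalSquare_subset_unitSquare n q)
  have hcont := fun m : ℕ => (continuous_cornerMoment_and_eLpNorm_le hn hp hμ m
    (F := fun _ => F) hFq hF1).1
  set C : ENNReal := μ Set.univ ^ (ENNReal.ofReal p).toReal⁻¹ with hC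
  have hCtop : C ≠ ⊤ := ENNReal.rpow_ne_top_of_nonneg (by positivity) (measure_ne_top _ _)
  have hK : ∀ K : ℕ,
      eLpNorm (ext unitSquare F - cornerSum n fun q => ∫ ξ in canonicalSquare n q, F ξ)
        (ENNReal.ofReal p) μ ≤ C * ENNReal.ofReal ((n : ℝ) ^ 2 * (3 * (1 / 10) ^ (K + 1))) +
          ENNReal.ofReal (1 / 4) * cornerNorm n p μ := by
    intro K
    set tail : Space → ℂ := ∑ m ∈ Finset.range K, fun x => expCoeff (m + 1) *
      cornerMoment n (fun _ => F) (m + 1) x with htail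
    have htc : Continuous tail := by
      have : tail = fun x => ∑ m ∈ Finset.range K, expCoeff (m + 1) *
          cornerMoment n (fun _ => F) (m + 1) x := by ext; simp [htail]
      rw [this]
      exact continuous_finsetSum _ fun m _ => continuous_const.mul (hcont _)
    have hsplit : ext unitSquare F - cornerSum n (fun q => ∫ ξ in canonicalSquare n q, F ξ) =
        (fun x => ext unitSquare F x - ∑ m ∈ Finset.range (K + 1),
          expCoeff m * cornerMoment n (fun _ => F) m x) + tail := by
      ext x
      simp only [Pi.sub_apply, Pi.add_apply, htail, Finset.sum_apply]
      rw [Finset.sum_range_succ', cornerMoment_zero]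
      simp [expCoeff]
      ring
    rw [hsplit]
    refine (eLpNorm_add_le (Continuous.aestronglyMeasurable ?_) htc.aestronglyMeasurable
      (by simpa using hp)).trans (add_le_add ?_ (eLpNorm_sum_cornerMoment_le hn hp hμ hF hF1 K))
    · exact (continuous_ext hF).sub
        (continuous_finsetSum _ fun m _ => continuous_const.mul (hcont _))
    · refine eLpNorm_le_of_ae_bound ?_
      filter_upwards [hμ] with x hx
      exact norm_ext_sub_sum_cornerMoment_le hn hF hF1 hx (K + 1)
  -- The left-hand side does not involve `K`, so the truncation error disappears in the limit.
  have hlim : Filter.Tendsto (fun K : ℕ =>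
      C * ENNReal.ofReal ((n : ℝ) ^ 2 * (3 * (1 / 10) ^ (K + 1))) +
        ENNReal.ofReal (1 / 4) * cornerNorm n p μ) Filter.atTop
      (nhds (C * ENNReal.ofReal ((n : ℝ) ^ 2 * (3 * 0)) +
        ENNReal.ofReal (1 / 4) * cornerNorm n p μ)) := by
    refine Filter.Tendsto.add ?_ tendsto_const_nhds
    refine ENNReal.Tendsto.const_mul ?_ (Or.inr hCtop)
    refine (ENNReal.continuous_ofReal.tendsto _).comp ?_
    refine Filter.Tendsto.const_mul _ (Filter.Tendsto.const_mul _ ?_)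
    exact (tendsto_pow_atTop_nhds_zero_of_lt_one (by norm_num) (by norm_num)).comp
      (Filter.tendsto_add_atTop_nat 1)
  have := ge_of_tendsto' hlim hK
  simpa using this

lemma integral_stepFun_canonicalSquare (hn : 1 ≤ n) (b : Fin n × Fin n → ℂ) (q : Fin n × Fin n) :
    ∫ ξ in canonicalSquare n q, stepFun n b ξ = b q := by
  have hn' : (n : ℂ) ≠ 0 := by exact_mod_cast (by omega : n ≠ 0)
  rw [integral_congr_ae (stepFun_ae_eq n b q), setIntegral_const, measureReal_def,
    volume_canonicalSquare, ENNReal.toReal_ofReal (by positivity), Complex.real_smul]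
  push_cast
  field_simp

lemma integral_norm_stepFun_canonicalSquare (hn : 1 ≤ n) (b : Fin n × Fin n → ℂ)
    (q : Fin n × Fin n) : ∫ ξ in canonicalSquare n q, ‖stepFun n b ξ‖ = ‖b q‖ := by
  have hn' : (n : ℝ) ≠ 0 := by exact_mod_cast (by omega : n ≠ 0)
  have h : ∀ᵐ ξ ∂(volume.restrict (canonicalSquare n q)), ‖stepFun n b ξ‖ = (n : ℝ) ^ 2 * ‖b q‖ := by
    filter_upwards [stepFun_ae_eq n b q] with ξ hξ
    rw [hξ, norm_mul, norm_pow, Complex.norm_natCast]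
  rw [integral_congr_ae h, setIntegral_const, measureReal_def,
    volume_canonicalSquare, ENNReal.toReal_ofReal (by positivity), smul_eq_mul]
  field_simp

lemma cornerNorm_ne_top (n : ℕ) (p : ℝ) (μ : Measure Space) [IsFiniteMeasure μ] :
    cornerNorm n p μ ≠ ⊤ := by
  refine ne_top_of_le_ne_top (b := μ Set.univ ^ (ENNReal.ofReal p).toReal⁻¹ *
    ENNReal.ofReal ((n : ℝ) ^ 2)) ?_ (iSup_le fun b => ?_)
  · exact ENNReal.mul_ne_top (ENNReal.rpow_ne_top_of_nonneg (by positivity) (measure_ne_top _ _))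
      ENNReal.ofReal_ne_top
  · exact eLpNorm_le_of_ae_bound (Filter.Eventually.of_forall fun x => norm_cornerSum_le b.2 x)

/-- On a ball of radius `n/1000`, an `L^p` bound for the extension of step functions gives one for
the extension of arbitrary functions. -/
theorem eLpNorm_ext_le_of_stepFun (hn : 1 ≤ n) (hp : 1 ≤ p) [IsFiniteMeasure μ]
    (hμ : ∀ᵐ x ∂μ, ‖x‖ ≤ n / 1000) {T : ENNReal} (hT : ∀ b : Fin n × Fin n → ℂ,
      (∀ q, ‖b q‖ ≤ 1) → eLpNorm (ext unitSquare (stepFun n b)) (ENNReal.ofReal p) μ ≤ T)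
    {F : Plane → ℂ} (hF : IntegrableOn F unitSquare)
    (hF1 : ∀ q, ∫ ξ in canonicalSquare n q, ‖F ξ‖ ≤ 1) :
    eLpNorm (ext unitSquare F) (ENNReal.ofReal p) μ ≤ 3 * T := by
  rcases eq_or_ne T ⊤ with rfl | hTtop
  · simp
  have hp1 : 1 ≤ ENNReal.ofReal p := by simpa using hp
  set B := cornerNorm n p μ with hB
  have hBtop : B ≠ ⊤ := cornerNorm_ne_top n p μ
  -- The step function with values `b` has `cornerSum n b` as its corner sum, so the comparison
  -- bounds `B` by itself.
  have h1 : B ≤ T + ENNReal.ofReal (1 / 4) * B := by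
    refine iSup_le fun b => ?_
    have hint := (integrable_stepFun n b.1).integrableOn (s := unitSquare)
    have hd := eLpNorm_ext_sub_cornerSum_le hn hp hμ hint fun q =>
      (integral_norm_stepFun_canonicalSquare hn b.1 q).le.trans (b.2 q)
    simp_rw [integral_stepFun_canonicalSquare hn] at hd
    have hc : cornerSum n b.1 = ext unitSquare (stepFun n b.1) -
        (ext unitSquare (stepFun n b.1) - cornerSum n b.1) := by simp
    rw [hc]
    refine (eLpNorm_sub_le (continuous_ext hint).aestronglyMeasurable
      ((continuous_ext hint).sub (continuous_cornerSum n _)).aestronglyMeasurable hp1).trans ?_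
    exact add_le_add (hT b.1 b.2) hd
  have h2 : eLpNorm (ext unitSquare F) (ENNReal.ofReal p) μ ≤ B + ENNReal.ofReal (1 / 4) * B := by
    have hd := eLpNorm_ext_sub_cornerSum_le hn hp hμ hF hF1
    have hc : ext unitSquare F = cornerSum n (fun q => ∫ ξ in canonicalSquare n q, F ξ) +
        (ext unitSquare F - cornerSum n fun q => ∫ ξ in canonicalSquare n q, F ξ) := by simp
    rw [hc]
    refine (eLpNorm_add_le (continuous_cornerSum n _).aestronglyMeasurable
      ((continuous_ext hF).sub (continuous_cornerSum n _)).aestronglyMeasurable hp1).trans ?_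
    refine add_le_add ?_ (by simpa using hd)
    exact le_iSup (fun b : {b : Fin n × Fin n → ℂ // ∀ q, ‖b q‖ ≤ 1} =>
      eLpNorm (cornerSum n b) (ENNReal.ofReal p) μ)
      ⟨_, fun q => (norm_integral_le_integral_norm _).trans (hF1 q)⟩
  refine h2.trans ?_
  clear_value B
  -- Since `B` is finite, `B ≤ 4T/3`, and then `5B/4 ≤ 5T/3 ≤ 3T`.
  lift B to NNReal using hBtop
  lift T to NNReal using hTtop
  have hq : ENNReal.ofReal (1 / 4) = ((1 / 4 : NNReal) : ENNReal) := by
    rw [ENNReal.ofReal]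
    congr 1
    ext
    simp
  rw [hq] at h1 ⊢
  norm_cast at h1 ⊢
  rw [← NNReal.coe_le_coe] at h1 ⊢
  push_cast at h1 ⊢
  linarith [T.coe_nonneg]

/-! ### From step functions to bounded functions, and covering by small balls. -/

lemma eLpNorm_eq_of_continuous_of_bounded {f : Space → ℂ} (hf : Continuous f) {H : ℝ}
    (hH : ∀ x, ‖f x‖ ≤ H) (hp : 1 ≤ p) (μ : Measure Space) [IsFiniteMeasure μ] :
    eLpNorm f (ENNReal.ofReal p) μ = ENNReal.ofReal ((∫ x, ‖f x‖ ^ p ∂μ) ^ p⁻¹) := by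
  have hp0 : 0 < p := by linarith
  have h := (MemLp.of_bound (p := ENNReal.ofReal p) hf.aestronglyMeasurable H
    (Filter.Eventually.of_forall hH) : MemLp f (ENNReal.ofReal p) μ).eLpNorm_eq_integral_rpow_norm
    (by simpa using hp0) ENNReal.ofReal_ne_top
  rwa [ENNReal.toReal_ofReal hp0.le] at h

lemma setIntegral_norm_le_of_ae_le {F : Plane → ℂ} (hF : IntegrableOn F unitSquare) {H : ℝ}
    (hH : ∀ᵐ ξ ∂(volume.restrict unitSquare), ‖F ξ‖ ≤ H) (q : Fin n × Fin n) :
    ∫ ξ in canonicalSquare n q, ‖F ξ‖ ≤ H * ((n : ℝ) ^ 2)⁻¹ := by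
  have hsub := canonicalSquare_subset_unitSquare n q
  have hvol : volume.real (canonicalSquare n q) = ((n : ℝ) ^ 2)⁻¹ := by
    rw [measureReal_def, volume_canonicalSquare, ENNReal.toReal_ofReal (by positivity)]
  calc ∫ ξ in canonicalSquare n q, ‖F ξ‖ ≤ ∫ ξ in canonicalSquare n q, H := by
        refine setIntegral_mono_ae_restrict (hF.mono_set hsub).norm (integrableOn_const ?_)
          (ae_restrict_of_ae_restrict_of_subset hsub hH)
        rw [volume_canonicalSquare]
        exact ENNReal.ofReal_ne_top
    _ = _ := by
        rw [setIntegral_const, hvol, smul_eq_mul, mul_comm]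

lemma unitSquare_eq : unitSquare = canonicalSquare 1 (0, 0) := by
  rw [← ensemble_univ le_rfl, ensemble]
  simp only [Finset.mem_univ, Set.iUnion_true]
  exact (Set.iUnion_congr fun q => congrArg _ (Subsingleton.elim q (0, 0))).trans (Set.iUnion_const _)

lemma integrableOn_unitSquare_of_ae_le {F : Plane → ℂ}
    (hF : AEStronglyMeasurable F (volume.restrict unitSquare)) {H : ℝ}
    (hH : ∀ᵐ ξ ∂(volume.restrict unitSquare), ‖F ξ‖ ≤ H) : IntegrableOn F unitSquare := by
  refine IntegrableOn.of_bound ?_ hF H hH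
  rw [unitSquare_eq, volume_canonicalSquare]
  exact ENNReal.ofReal_lt_top

lemma setIntegral_unitSquare_norm_le {F : Plane → ℂ} (hF : IntegrableOn F unitSquare) {H : ℝ}
    (hH : ∀ᵐ ξ ∂(volume.restrict unitSquare), ‖F ξ‖ ≤ H) : ∫ ξ in unitSquare, ‖F ξ‖ ≤ H := by
  have h := setIntegral_norm_le_of_ae_le hF hH (n := 1) (0, 0)
  rw [← unitSquare_eq] at h
  simpa using h

lemma setIntegral_ball_add (f : Space → ℝ) (z : Space) (r : ℝ) :
    ∫ x in Metric.ball 0 r, f (z + x) = ∫ x in Metric.ball z r, f x := by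
  have h := (measurePreserving_add_left (volume : Measure Space) z).setIntegral_preimage_emb
    (measurableEmbedding_addLeft z) f (Metric.ball z r)
  rw [← h]
  congr 2
  ext x
  simp [Metric.mem_ball, dist_eq_norm]

/-- The passage from step functions to bounded functions, on balls of radius `n/1000`. -/
lemma integral_small_ball_le_of_stepFun (hn : 1 ≤ n) (hp : 1 ≤ p) {T : ℝ}
    (hT : ∀ b : Fin n × Fin n → ℂ, (∀ q, ‖b q‖ ≤ 1) →
      ∫ x in Metric.ball 0 ((n : ℝ) / 1000), ‖ext unitSquare (stepFun n b) x‖ ^ p ≤ T)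
    {F : Plane → ℂ} (hF : IntegrableOn F unitSquare) {K : ℝ} (hK : 0 < K)
    (hFK : ∀ᵐ ξ ∂(volume.restrict unitSquare), ‖F ξ‖ ≤ K * (n : ℝ) ^ 2) (z : Space) :
    ∫ x in Metric.ball z ((n : ℝ) / 1000), ‖ext unitSquare F x‖ ^ p ≤ (3 * K) ^ p * T := by
  have hn' : (0 : ℝ) < n := by exact_mod_cast hn
  have hp0 : 0 < p := by linarith
  have hT0 : 0 ≤ T := (setIntegral_nonneg measurableSet_ball fun x _ => by positivity).trans
    (hT 0 (by simp))
  set μ : Measure Space := volume.restrict (Metric.ball 0 ((n : ℝ) / 1000)) with hμ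
  have : IsFiniteMeasure μ := ⟨by rw [hμ, Measure.restrict_apply_univ]; exact measure_ball_lt_top⟩
  have hμn : ∀ᵐ x ∂μ, ‖x‖ ≤ n / 1000 := by
    filter_upwards [ae_restrict_mem measurableSet_ball] with x hx
    rw [mem_ball_zero_iff] at hx
    exact hx.le
  -- The modulation recentres the ball at the origin. Division by `K` leaves `|F'| ≤ n²`, so the
  -- integral over a square of area `n⁻²` is at most 1.
  set F' : Plane → ℂ := fun ξ => ((K⁻¹ : ℝ) : ℂ) * (F ξ * e (inner ℝ (lift ξ) z)) with hF'
  have hF'int : IntegrableOn F' unitSquare := (integrableOn_integrand hF z).const_mul _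
  have hF'norm : ∀ ξ, ‖F' ξ‖ = K⁻¹ * ‖F ξ‖ := fun ξ => by
    rw [hF', norm_mul, norm_integrand, Complex.norm_real, Real.norm_of_nonneg (by positivity)]
  have hF'1 : ∀ q, ∫ ξ in canonicalSquare n q, ‖F' ξ‖ ≤ 1 := fun q => by
    have h := setIntegral_norm_le_of_ae_le hF'int (H := (n : ℝ) ^ 2) (by
      filter_upwards [hFK] with ξ hξ
      rw [hF'norm]
      calc K⁻¹ * ‖F ξ‖ ≤ K⁻¹ * (K * (n : ℝ) ^ 2) := by gcongr
        _ = _ := by field_simp) q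
    rwa [mul_inv_cancel₀ (by positivity)] at h
  have hF'ext : ∀ x, ext unitSquare F' x = ((K⁻¹ : ℝ) : ℂ) * ext unitSquare F (z + x) := fun x => by
    rw [hF', ext_const_mul, ext_modulate]
  have hmain := eLpNorm_ext_le_of_stepFun hn hp hμn (T := ENNReal.ofReal (T ^ p⁻¹)) (fun b hb => by
    rw [eLpNorm_eq_of_continuous_of_bounded
      (continuous_ext (integrable_stepFun n b).integrableOn) (norm_ext_le _ _) hp]
    refine ENNReal.ofReal_le_ofReal (Real.rpow_le_rpow ?_ (hT b hb) (by positivity))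
    exact integral_nonneg fun x => by positivity) hF'int hF'1
  rw [eLpNorm_eq_of_continuous_of_bounded (continuous_ext hF'int) (norm_ext_le _ _) hp,
    show (3 : ENNReal) = ENNReal.ofReal 3 by simp, ← ENNReal.ofReal_mul (by norm_num),
    ENNReal.ofReal_le_ofReal_iff (by positivity)] at hmain
  have hint : ∫ x, ‖ext unitSquare F' x‖ ^ p ∂μ =
      K⁻¹ ^ p * ∫ x in Metric.ball z ((n : ℝ) / 1000), ‖ext unitSquare F x‖ ^ p := by
    rw [← setIntegral_ball_add (fun x => ‖ext unitSquare F x‖ ^ p), ← integral_const_mul]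
    refine integral_congr_ae (Filter.Eventually.of_forall fun x => ?_)
    simp only [hF'ext]
    rw [norm_mul, Complex.norm_real, Real.norm_of_nonneg (by positivity),
      Real.mul_rpow (by positivity) (norm_nonneg _)]
  have hI0 : 0 ≤ ∫ x, ‖ext unitSquare F' x‖ ^ p ∂μ := integral_nonneg fun x => by positivity
  have h2 := Real.rpow_le_rpow (by positivity) hmain hp0.le
  rw [← Real.rpow_mul hI0, inv_mul_cancel₀ hp0.ne', Real.rpow_one,
    Real.mul_rpow (by norm_num) (by positivity), ← Real.rpow_mul hT0, inv_mul_cancel₀ hp0.ne',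
    Real.rpow_one, hint, Real.inv_rpow hK.le, inv_mul_le_iff₀ (by positivity)] at h2
  rw [Real.mul_rpow (by norm_num) hK.le]
  linarith

/-- Dilating one fixed cover by `n` covers every ball of radius `n` by a number of balls of radius
`n/1000` independent of `n`. -/
lemma exists_finset_cover_unitBall :
    ∃ t : Finset Space, Metric.ball (0 : Space) 1 ⊆ ⋃ y ∈ t, Metric.ball y (1 / 1000) := by
  obtain ⟨t, ht, hcov⟩ := Metric.totallyBounded_iff.1
    ((isCompact_closedBall (0 : Space) 1).totallyBounded) (1 / 1000) (by norm_num)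
  refine ⟨ht.toFinset, Metric.ball_subset_closedBall.trans (hcov.trans ?_)⟩
  simp

lemma integral_ball_le_sum_of_cover {t : Finset Space}
    (ht : Metric.ball (0 : Space) 1 ⊆ ⋃ y ∈ t, Metric.ball y (1 / 1000)) (hn : 1 ≤ n)
    {f : Space → ℝ} (hf : Continuous f) (hf0 : ∀ x, 0 ≤ f x) (c : Space) :
    ∫ x in Metric.ball c n, f x ≤
      ∑ y ∈ t, ∫ x in Metric.ball (c + (n : ℝ) • y) ((n : ℝ) / 1000), f x := by
  have hn' : (0 : ℝ) < n := by exact_mod_cast hn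
  have hcov : Metric.ball c n ⊆ ⋃ y : t, Metric.ball (c + (n : ℝ) • (y : Space)) ((n : ℝ) / 1000) := by
    intro x hx
    rw [mem_ball_iff_norm] at hx
    have h1 : (n : ℝ)⁻¹ • (x - c) ∈ Metric.ball (0 : Space) 1 := by
      rw [mem_ball_zero_iff, norm_smul, norm_inv, Real.norm_of_nonneg hn'.le, inv_mul_lt_iff₀ hn']
      linarith
    obtain ⟨y, hy, hxy⟩ := Set.mem_iUnion₂.1 (ht h1)
    refine Set.mem_iUnion.2 ⟨⟨y, hy⟩, ?_⟩
    rw [mem_ball_iff_norm] at hxy ⊢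
    have h2 : x - (c + (n : ℝ) • y) = (n : ℝ) • ((n : ℝ)⁻¹ • (x - c) - y) := by
      rw [smul_sub, smul_inv_smul₀ hn'.ne', sub_sub]
    rw [h2, norm_smul, Real.norm_of_nonneg hn'.le]
    calc (n : ℝ) * _ < n * (1 / 1000) := by gcongr
      _ = _ := by ring
  have hint : ∀ (z : Space) (r : ℝ), IntegrableOn f (Metric.ball z r) := fun z r =>
    (hf.continuousOn.integrableOn_compact (isCompact_closedBall z r)).mono_set
      Metric.ball_subset_closedBall
  have hle : (volume : Measure Space).restrict (Metric.ball c n) ≤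
      ∑ y : t, volume.restrict (Metric.ball (c + (n : ℝ) • (y : Space)) ((n : ℝ) / 1000)) := by
    refine (Measure.restrict_mono hcov le_rfl).trans (Measure.restrict_iUnion_le.trans ?_)
    rw [Measure.sum_fintype]
  have hint' : ∀ y ∈ (Finset.univ : Finset t), Integrable f
      (volume.restrict (Metric.ball (c + (n : ℝ) • (y : Space)) ((n : ℝ) / 1000))) :=
    fun y _ => hint _ _
  calc _ ≤ ∫ x, f x ∂(∑ y : t,
        volume.restrict (Metric.ball (c + (n : ℝ) • (y : Space)) ((n : ℝ) / 1000))) :=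
        integral_mono_measure hle (Filter.Eventually.of_forall hf0)
          (integrable_finsetSum_measure.2 hint')
    _ = _ := by
        rw [integral_finsetSum_measure hint']
        exact Finset.sum_coe_sort t fun y =>
          ∫ x in Metric.ball (c + (n : ℝ) • y) ((n : ℝ) / 1000), f x

/-- The trivial bound for the extension operator on a ball. -/
lemma integral_ball_ext_le_trivial (hp : 0 ≤ p) {F : Plane → ℂ} (hF : IntegrableOn F unitSquare)
    {H : ℝ} (hH : ∀ᵐ ξ ∂(volume.restrict unitSquare), ‖F ξ‖ ≤ H) {r : ℝ} (hr : 0 ≤ r)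
    (c : Space) :
    ∫ x in Metric.ball c r, ‖ext unitSquare F x‖ ^ p ≤ H ^ p * (r ^ 3 * unitBallVolume) := by
  have h := norm_setIntegral_le_of_norm_le_const (μ := volume)
    (s := Metric.ball c r) measure_ball_lt_top (f := fun x => ‖ext unitSquare F x‖ ^ p)
    (C := H ^ p) (fun x _ => (norm_ext_rpow_le unitSquare F hp x).trans
      (Real.rpow_le_rpow (integral_nonneg fun _ => norm_nonneg _)
        (setIntegral_unitSquare_norm_le hF hH) hp))
  rw [measureReal_def, volume_ball_eq c hr, ENNReal.toReal_ofReal (by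
    have := unitBallVolume_pos
    positivity)] at h
  exact (le_abs_self _).trans h

/-- The local bound, when the number of parts is large compared with the decoupling constant. -/
lemma integral_ball_ext_le_of_decouples {t : Finset Space}
    (ht : Metric.ball (0 : Space) 1 ⊆ ⋃ y ∈ t, Metric.ball y (1 / 1000)) {M k : ℕ} {κ : ℝ}
    (hn : 1 ≤ n) (hM : 1 ≤ M) (hk : n ^ 2 = M * k) (hp : 2 ≤ p) (hp' : p ≤ 4) (hκ : 3 < κ)
    {D : ℝ} (hD : 0 ≤ D) (hdec : DecouplesWith p κ n M D)
    (hsmall : D * 2 ^ p * weightConst κ ≤ k / 2) {ε : ℝ} (hε : 0 < ε)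
    {F : Plane → ℂ} (hF : IntegrableOn F unitSquare) {K : ℝ} (hK : 0 < K)
    (hFK : ∀ᵐ ξ ∂(volume.restrict unitSquare), ‖F ξ‖ ≤ K * (n : ℝ) ^ 2) (c : Space) :
    ∫ x in Metric.ball c n, ‖ext unitSquare F x‖ ^ p ≤
      t.card * ((3 * K) ^ p * (40 * D * 2 ^ p *
        ((bushConst (p / 2) (max p 3 + ε) κ + bushConst 1 (3 + ε) κ) *
          (((n : ℝ) ^ 2) ^ (ε / 2) * (((n : ℝ) ^ 2) ^ ((3 + p) / 2) +
            ((n : ℝ) ^ 2) ^ (3 : ℕ) * (k : ℝ) ^ (p / 2 - 1)))))) := by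
  have hn' : (0 : ℝ) < n := by exact_mod_cast hn
  have hn1 : (1 : ℝ) ≤ n := by exact_mod_cast hn
  have hR1 : (1 : ℝ) ≤ (n : ℝ) ^ 2 := one_le_pow₀ hn1
  have hnR : (n : ℝ) / 1000 ≤ (n : ℝ) ^ 2 := by nlinarith
  have hk1 : (1 : ℝ) ≤ k := by
    have : k ≠ 0 := by
      rintro rfl
      have : 0 < n ^ 2 := by positivity
      omega
    exact_mod_cast Nat.one_le_iff_ne_zero.2 this
  have hB1 := bushConst_nonneg (p / 2) (max p 3 + ε) κ
  have hB2 := bushConst_nonneg 1 (3 + ε) κ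
  set B1 := bushConst (p / 2) (max p 3 + ε) κ
  set B2 := bushConst 1 (3 + ε) κ
  set R : ℝ := (n : ℝ) ^ 2 with hR
  have hR0 : 0 < R := by linarith
  set P : ℝ := R ^ ((3 + p) / 2) with hP
  set Q : ℝ := R ^ (3 : ℕ) * (k : ℝ) ^ (p / 2 - 1) with hQ
  have hkp : 1 ≤ (k : ℝ) ^ (p / 2 - 1) := Real.one_le_rpow hk1 (by linarith)
  have hR3 : R ^ (3 : ℕ) ≤ Q := le_mul_of_one_le_right (by positivity) hkp
  have hP0 : 0 ≤ P := by positivity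
  -- The bush estimate requires both `σ > 3` and `σ ≥ p`. For `p ≥ 3` the exponent is `(3 + p)/2`
  -- plus `ε/2`; for `p ≤ 3` it is `3` plus `ε/2`, which the second term covers.
  have hσ : R ^ ((max p 3 + ε + 3) / 2) ≤ R ^ (ε / 2) * (P + Q) := by
    have e1 : R ^ ((max p 3 + ε + 3) / 2) = R ^ (ε / 2) * R ^ ((max p 3 + 3) / 2) := by
      rw [← Real.rpow_add hR0]
      congr 1
      ring
    rw [e1]
    gcongr
    rcases le_total p 3 with h | h
    · rw [max_eq_right h, show ((3 : ℝ) + 3) / 2 = (3 : ℕ) by norm_num, Real.rpow_natCast]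
      linarith
    · rw [max_eq_left h, add_comm p]
      have : 0 ≤ Q := by positivity
      linarith
  have hτ : (k : ℝ) ^ (p / 2 - 1) * R ^ ((3 + ε + 3) / 2) = R ^ (ε / 2) * Q := by
    have e1 : R ^ ((3 + ε + 3) / 2) = R ^ (ε / 2) * R ^ (3 : ℕ) := by
      rw [← Real.rpow_natCast R 3, ← Real.rpow_add hR0]
      congr 1
      push_cast
      ring
    rw [e1, hQ]
    ring
  have hstep : ∀ b : Fin n × Fin n → ℂ, (∀ q, ‖b q‖ ≤ 1) →
      ∫ x in Metric.ball 0 ((n : ℝ) / 1000), ‖ext unitSquare (stepFun n b) x‖ ^ p ≤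
        40 * D * 2 ^ p * ((B1 + B2) * (R ^ (ε / 2) * (P + Q))) := by
    intro b hb
    have h := integral_ball_ext_stepFun_le hn hM hk hp hp' hκ hb hD hdec hsmall
      (σ := max p 3 + ε) (τ := 3 + ε) (by linarith [le_max_right p 3])
      (by linarith [le_max_left p 3]) (by linarith) 0
    -- The small ball is enlarged to radius `R`; the bush is concentrated near the origin, so this
    -- costs nothing relevant.
    refine le_trans (setIntegral_mono_set ?_ ?_ ?_) (h.trans ?_)
    · exact ((continuous_norm_ext_rpow (integrable_stepFun n b).integrableOn
        (by linarith)).continuousOn.integrableOn_compact (isCompact_closedBall _ _)).mono_set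
          Metric.ball_subset_closedBall
    · exact Filter.Eventually.of_forall fun x => by positivity
    · exact (Metric.ball_subset_ball hnR).eventuallyLE
    · gcongr
      calc _ = B1 * R ^ ((max p 3 + ε + 3) / 2) +
            B2 * ((k : ℝ) ^ (p / 2 - 1) * R ^ ((3 + ε + 3) / 2)) := by ring
        _ ≤ B1 * (R ^ (ε / 2) * (P + Q)) + B2 * (R ^ (ε / 2) * (P + Q)) := by
            rw [hτ]
            gcongr
            linarith
        _ = _ := by ring
  refine (integral_ball_le_sum_of_cover ht hn (continuous_norm_ext_rpow hF (by linarith))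
    (fun x => by positivity) c).trans ?_
  rw [← nsmul_eq_mul]
  exact Finset.sum_le_card_nsmul _ _ _ fun y _ =>
    integral_small_ball_le_of_stepFun hn (by linarith) hstep hF hK hFK _

end LargeEnsemble
end
-- Choice of parameters and conclusion.
open LargeEnsemble in
theorem theorem2p1
    (γ p : ℝ) (hγ : 0 < γ) (hγ' : γ ≤ 1) (hp : 2 ≤ p) (hp' : p ≤ 4)
    -- the exponent of decay of the weights, and the implicit constants in `M ∼ R^(1-γ)`
    (κ : ℝ) (hκ : 3 < κ) (a b : ℝ) (ha : 0 < a)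
    -- the pairs `(n, M)` under consideration, where `R = n²`
    (scales : Set (ℕ × ℕ))
    (hscales : ∀ n M : ℕ, (n, M) ∈ scales →
      1 ≤ n ∧ M ∣ n ^ 2 ∧
        a * ((n : ℝ) ^ 2) ^ (1 - γ) ≤ M ∧ (M : ℝ) ≤ b * ((n : ℝ) ^ 2) ^ (1 - γ))
    (hdec : ∀ ε : ℝ, 0 < ε → ∃ C : ℝ, ∀ n M : ℕ, (n, M) ∈ scales →
      DecouplesWith p κ n M (C * ((n : ℝ) ^ 2) ^ ε)) :
    ∀ ε : ℝ, 0 < ε → ∀ K : ℝ, ∃ C : ℝ, ∀ n M : ℕ, (n, M) ∈ scales →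
      ∀ F : Plane → ℂ, AEStronglyMeasurable F (volume.restrict unitSquare) →
      (∀ᵐ ξ ∂(volume.restrict unitSquare), ‖F ξ‖ ≤ K * (n : ℝ) ^ 2) →
      ∀ c : Space,
        ∫ x in Metric.ball c (Real.sqrt ((n : ℝ) ^ 2)), ‖ext unitSquare F x‖ ^ p ≤
          C * ((n : ℝ) ^ 2) ^ ε *
            (((n : ℝ) ^ 2) ^ ((3 + p) / 2) +
              ((n : ℝ) ^ 2) ^ (3 : ℕ) * ((n : ℝ) ^ 2 / M) ^ (p / 2 - 1)) := by
  intro ε hε K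
  obtain ⟨t, ht⟩ := exists_finset_cover_unitBall
  -- The bound `ε/2` leaves room for the loss `R^(ε/2)` of the bush moments; `γ/2` leaves a power of
  -- `R` to spare against `k ≳ R^γ`.
  set δ : ℝ := min (ε / 2) (γ / 2) with hδ
  have hδ0 : 0 < δ := lt_min (by linarith) (by linarith)
  obtain ⟨C₀, hC₀⟩ := hdec δ hδ0
  set K' : ℝ := |K| + 1 with hK'
  have hK'0 : 0 < K' := by positivity
  have hw := weightConst_nonneg κ
  have hv := unitBallVolume_pos
  have hB1 := bushConst_nonneg (p / 2) (max p 3 + ε) κ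
  have hB2 := bushConst_nonneg 1 (3 + ε) κ
  set B : ℝ := bushConst (p / 2) (max p 3 + ε) κ + bushConst 1 (3 + ε) κ with hB
  -- the threshold for `R ^ (γ / 2)` above which the coherent part can be absorbed
  set H : ℝ := 2 * |b| * (|C₀| * 2 ^ p * weightConst κ) with hH
  have hH0 : 0 ≤ H := by positivity
  set R₀ : ℝ := H ^ (2 / γ) with hR₀
  set Cmain : ℝ := t.card * ((3 * K') ^ p * (40 * |C₀| * 2 ^ p * B)) with hCmain
  set Ctriv : ℝ := (K' * R₀) ^ p * (R₀ ^ 3 * unitBallVolume) with hCtriv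
  have hCmain0 : 0 ≤ Cmain := by positivity
  have hCtriv0 : 0 ≤ Ctriv := by positivity
  refine ⟨Cmain + Ctriv, fun n M hnM F hFm hFK c => ?_⟩
  obtain ⟨hn, ⟨k, hk⟩, haM, hbM⟩ := hscales n M hnM
  have hn1 : (1 : ℝ) ≤ n := by exact_mod_cast hn
  have hR1 : (1 : ℝ) ≤ (n : ℝ) ^ 2 := one_le_pow₀ hn1
  have hM : 1 ≤ M := by
    have hMpos : (0 : ℝ) < M := lt_of_lt_of_le (by positivity) haM
    exact_mod_cast hMpos
  have hM' : (0 : ℝ) < M := by exact_mod_cast hM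
  have hkR : (n : ℝ) ^ 2 = M * k := by exact_mod_cast hk
  have hRk : (n : ℝ) ^ 2 / M = k := by rw [hkR]; field_simp
  have hFK' : ∀ᵐ ξ ∂(volume.restrict unitSquare), ‖F ξ‖ ≤ K' * (n : ℝ) ^ 2 := by
    filter_upwards [hFK] with ξ hξ
    refine hξ.trans ?_
    gcongr
    rw [hK']
    linarith [le_abs_self K]
  have hF := integrableOn_unitSquare_of_ae_le hFm hFK'
  rw [Real.sqrt_sq (by linarith), hRk]
  have hnR : (n : ℝ) ≤ (n : ℝ) ^ 2 := by nlinarith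
  set R : ℝ := (n : ℝ) ^ 2 with hR
  have hR0 : 0 < R := by linarith
  set S : ℝ := R ^ ((3 + p) / 2) + R ^ (3 : ℕ) * (k : ℝ) ^ (p / 2 - 1) with hS
  have hS1 : 1 ≤ S := by
    have h1 : 1 ≤ R ^ ((3 + p) / 2) := Real.one_le_rpow hR1 (by linarith)
    have h2 : 0 ≤ R ^ (3 : ℕ) * (k : ℝ) ^ (p / 2 - 1) := by positivity
    linarith
  have hRε : 1 ≤ R ^ ε := Real.one_le_rpow hR1 hε.le
  have hRS : 1 ≤ R ^ ε * S := one_le_mul_of_one_le_of_one_le hRε hS1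
  rcases le_or_gt H (R ^ (γ / 2)) with hlarge | hsmallR
  · have hD : DecouplesWith p κ n M (|C₀| * R ^ δ) := by
      intro P hP G hG z
      refine (hC₀ n M hnM P hP G hG z).trans ?_
      gcongr
      · refine Finset.sum_nonneg fun A _ => integral_nonneg fun x => ?_
        exact mul_nonneg (by positivity) (ballWeight_pos z hR0 x).le
      · exact le_abs_self _
    have hγk : R ^ γ ≤ |b| * k := by
      have h1 : R ^ (1 - γ) * R ^ γ = R := by
        rw [← Real.rpow_add hR0]
        simp
      have h2 : R ^ (1 - γ) * R ^ γ ≤ R ^ (1 - γ) * (|b| * k) := by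
        rw [h1]
        calc R = M * k := hkR
          _ ≤ b * R ^ (1 - γ) * k := by gcongr
          _ ≤ |b| * R ^ (1 - γ) * k := by gcongr; exact le_abs_self b
          _ = _ := by ring
      exact le_of_mul_le_mul_left h2 (by positivity)
    have hsm : |C₀| * R ^ δ * 2 ^ p * weightConst κ ≤ k / 2 := by
      have h1 : R ^ δ ≤ R ^ (γ / 2) := Real.rpow_le_rpow_of_exponent_le hR1 (min_le_right _ _)
      have h2 : R ^ (γ / 2) * R ^ (γ / 2) = R ^ γ := by
        rw [← Real.rpow_add hR0]
        congr 1
        ring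
      have h3 : R ^ δ * H ≤ |b| * k := by
        calc R ^ δ * H ≤ R ^ (γ / 2) * R ^ (γ / 2) := by gcongr
          _ ≤ _ := h2.trans_le hγk
      -- If `b` were zero, the bound `R^γ ≤ |b| k` would fail.
      have hb : 0 < |b| := by
        by_contra! hb
        have : |b| * k ≤ 0 := mul_nonpos_of_nonpos_of_nonneg hb (by positivity)
        linarith [Real.rpow_pos_of_pos hR0 γ]
      have h4 : |b| * (2 * (|C₀| * R ^ δ * 2 ^ p * weightConst κ)) ≤ |b| * k := by
        refine le_trans (le_of_eq ?_) h3
        rw [hH]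
        ring
      linarith [le_of_mul_le_mul_left h4 hb]
    have h := integral_ball_ext_le_of_decouples ht hn hM hk hp hp' hκ (by positivity) hD hsm hε hF
      hK'0 hFK' c
    refine h.trans ?_
    have hδε : R ^ δ * R ^ (ε / 2) ≤ R ^ ε := by
      rw [← Real.rpow_add hR0]
      refine Real.rpow_le_rpow_of_exponent_le hR1 ?_
      linarith [min_le_left (ε / 2) (γ / 2)]
    calc _ = Cmain * ((R ^ δ * R ^ (ε / 2)) * S) := by rw [hCmain]; ring
      _ ≤ Cmain * (R ^ ε * S) := by gcongr
      _ ≤ (Cmain + Ctriv) * (R ^ ε * S) := by gcongr; linarith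
      _ = _ := by ring
  -- Below the threshold `R` is bounded in terms of the fixed parameters, and the trivial bound is a
  -- constant.
  · have hRR₀ : R ≤ R₀ := by
      have h1 : R = (R ^ (γ / 2)) ^ (2 / γ) := by
        rw [← Real.rpow_mul hR0.le, div_mul_div_comm, mul_comm γ 2, div_self (by positivity),
          Real.rpow_one]
      rw [h1, hR₀]
      gcongr
    calc _ ≤ (K' * R) ^ p * ((n : ℝ) ^ 3 * unitBallVolume) :=
          integral_ball_ext_le_trivial (by linarith) hF hFK' (by linarith) c
      _ ≤ (K' * R₀) ^ p * (R₀ ^ 3 * unitBallVolume) := by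
          gcongr
          linarith
      _ ≤ Cmain + Ctriv := by linarith
      _ ≤ (Cmain + Ctriv) * (R ^ ε * S) := le_mul_of_one_le_right (by positivity) hRS
      _ = _ := by ring
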